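/- Let $\mathfrak d$ be a finite-dimensional real Lie algebra with an invariant non-degenerate symmetric pairing $\langle\cdot,\cdot\rangle$, let $t\in(S^2\mathfrak d)^{\mathfrak d}$ be its inverse, with $t^\sharp:\mathfrak d^*\to\mathfrak d$, and let $\phi\in\bigwedge^3\mathfrak d$ be given by $\phi(\xi,\eta,\zeta)=\frac14\zeta([t^\sharp\xi,t^\sharp\eta])$. A $\mathfrak d$-quasi-Poisson manifold is a smooth manifold $M$ with an action $\rho$ of $\mathfrak d$ (a Lie algebra homomorphism to vector fields) and a $\mathfrak d$-invariant bivector field $\pi$ with $\frac12[\pi,\pi]=\rho^{\otimes3}(\phi)$ (the Schouten bracket normalized so that $\frac12[\pi,\pi](df,dg,dh)=\{f,\{g,h\}\}+\text{c.p.}$ with $\{f,g\}=\pi(df,dg)$). Put $\sigma=\pi+\frac12\rho^{\otimes2}(t)$. The left leaves of $M$ are the integral leaves (maximal connected integral manifolds) of the distribution $T^LM=\{\sigma(\cdot,\alpha)\mid\alpha\in T^*M\}$. $M$ is split-symplectic if the vectors $\rho(u)+\pi(\alpha,\cdot)$, $u\in\mathfrak d$, $\alpha\in T^*M$, fill $TM$,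 and if the stabilizer in $\mathfrak d$ of every left leaf (the set of $u$ such that $\rho(u)$ is tangent to the leaf) is Lagrangian, i.e. equal to its orthogonal complement. Let $N$ be a manifold with an action $\rho_N$ of $\mathfrak d$ all of whose point stabilizers $\mathfrak c$ are coisotropic ($\mathfrak c^\perp\subset\mathfrak c$). A smooth map $\mu_R:M\to N$ is right-central if it is $\mathfrak d$-equivariant and $\sigma(\cdot,d(f\circ\mu_R))=0$ for every $f\in C^\infty(N)$. Let $\mathfrak h\subset\mathfrak d$ be a Lagrangian Lie subalgebra and $\mathfrak h^*\subset\mathfrak d$ a Lagrangian complement of $\mathfrak h$, identified with the dual of $\mathfrak h$ by the pairing. Define $\delta_{\mathfrak h}:\mathfrak h\to\bigwedge^2\mathfrak h$ and $\phi_{\mathfrak h}\in\bigwedge^3\mathfrak h$ by $\delta_{\mathfrak h}(u)(\alpha,\beta)=\langle u,[\alpha,\beta]\rangle$ and $\phi_{\mathfrak h}(\alpha,\beta,\gamma)=\langle[\alpha,\beta],\gamma\rangle$ for $u\in\mathfrak h$ and $\alpha,\beta,\gamma\in\mathfrak h^*$. An $(\mathfrak h,\mathfrak d;\mathfrak h^*)$-quasi-Poisson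 manifold is a manifold $X$ with an action $\rho_X$ of $\mathfrak h$ and a bivector field $\pi_X$ such that $\frac12[\pi_X,\pi_X]=\rho_X^{\otimes3}(\phi_{\mathfrak h})$ and $[\rho_X(u),\pi_X]=-\rho_X^{\otimes2}(\delta_{\mathfrak h}(u))$ for all $u\in\mathfrak h$. A smooth map $\mu:X\to N$ is then a moment map if it is $\mathfrak h$-equivariant and $(1\otimes\mu_*)(\pi_X)=-(\rho_X\otimes1)(Z_N)$, where $Z_N\in\Gamma(\mathfrak h\otimes TN)$ is given by $\langle\alpha,Z_N\rangle=\rho_N(\alpha)$ for all $\alpha\in\mathfrak h^*$. \textbf{Theorem.} Let $(M,\rho,\pi)$ be a split-symplectic $\mathfrak d$-quasi-Poisson manifold, $X\subset M$ a left leaf, $\mathfrak h\subset\mathfrak d$ the stabilizer of $X$, and $\mathfrak h^*\subset\mathfrak d$ a Lagrangian complement of $\mathfrak h$. Let $\mu_R:M\to N$ be a right-central map. Then the action $\rho|_{\mathfrak h}$ and the bivector field $$\pi'=\pi-\rho^{\otimes2}\Bigl(\tfrac12\sum_i e_i\wedge e^i\Bigr)$$ (where $e_i$ is a basis of $\mathfrak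 h$, $e^i$ is the dual basis of $\mathfrak h^*$, and $a\wedge b=a\otimes b-b\otimes a$) restrict to $X$, the restrictions make $X$ an $(\mathfrak h,\mathfrak d;\mathfrak h^*)$-quasi-Poisson manifold, and $\mu_R|_X:X\to N$ is a moment map for this structure. -/

import Mathlib

open Set Manifold VectorField
open scoped Manifold ContDiff

universe u

noncomputable section

namespace QuasiPoisson

/-! ### The Lie algebra `𝔡` with its pairing -/

section Algebra

variable {𝔡 : Type*} [LieRing 𝔡] [LieAlgebra ℝ 𝔡]

/-- An invariant non-degenerate symmetric pairing on a Lie algebra. -/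
structure InvariantPairing (𝔡 : Type*) [LieRing 𝔡] [LieAlgebra ℝ 𝔡] where
  form : LinearMap.BilinForm ℝ 𝔡
  symm : ∀ a b, form a b = form b a
  nondegenerate : form.Nondegenerate
  invariant : ∀ a b c, form ⁅a, b⁆ c = form a ⁅b, c⁆

/-- A subspace `S` is Lagrangian if `S^⊥ = S`. -/
def IsLagrangian (B : InvariantPairing 𝔡) (S : Submodule ℝ 𝔡) : Prop :=
  B.form.orthogonal S = S

/-- A subspace `S` is coisotropic if `S^⊥ ⊆ S`; as the pairing is non-degenerate, this says that
the image of `t` in `S²(𝔡/S)` vanishes. -/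
def IsCoisotropic (B : InvariantPairing 𝔡) (S : Submodule ℝ 𝔡) : Prop :=
  B.form.orthogonal S ≤ S

/-- Elements of `V ⊗ V`, for `V` finite-dimensional, as bilinear forms on the dual of `V`;
this one is the element `a ⊗ b`, i.e. `(ξ, η) ↦ ξ(a) η(b)`. -/
def tensor {V : Type*} [AddCommGroup V] [Module ℝ V] (a b : V) :
    Module.Dual ℝ V →ₗ[ℝ] Module.Dual ℝ V →ₗ[ℝ] ℝ :=
  (Module.Dual.eval ℝ V a).smulRight (Module.Dual.eval ℝ V b)

variable [FiniteDimensional ℝ 𝔡]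

/-- The isomorphism `t^♯ : 𝔡^* → 𝔡` given by the pairing: `⟨t^♯ ξ, a⟩ = ξ(a)`. -/
def sharp (B : InvariantPairing 𝔡) : Module.Dual ℝ 𝔡 →ₗ[ℝ] 𝔡 :=
  (B.form.toDual B.nondegenerate).symm.toLinearMap

/-- The invariant element `t ∈ S²𝔡` inverse to the pairing, `t(ξ, η) = ⟨t^♯ ξ, t^♯ η⟩`. -/
def tElement (B : InvariantPairing 𝔡) : Module.Dual ℝ 𝔡 →ₗ[ℝ] Module.Dual ℝ 𝔡 →ₗ[ℝ] ℝ :=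
  B.form.compl₁₂ (sharp B) (sharp B)

/-- The element `φ ∈ ⋀³𝔡`, `φ(ξ, η, ζ) = ¼ ⟨[t^♯ ξ, t^♯ η], t^♯ ζ⟩ = ¼ ζ([t^♯ ξ, t^♯ η])`. -/
def phi (B : InvariantPairing 𝔡) (ξ η ζ : Module.Dual ℝ 𝔡) : ℝ :=
  (1 / 4) * ζ ⁅sharp B ξ, sharp B η⁆

variable {𝔥 : LieSubalgebra ℝ 𝔡} {𝔥s : Submodule ℝ 𝔡}

/-- For a Lagrangian Lie subalgebra `𝔥` with Lagrangian complement `𝔥s`, the identification of the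
dual of `𝔥` with `𝔥s` by the pairing: the element of `𝔥s` whose pairing with every
`a ∈ 𝔥` is `ξ(a)`. (It is computed as `t^♯` of the extension of `ξ` by zero on `𝔥s`.) -/
def toComplement (B : InvariantPairing 𝔡) (hc : IsCompl 𝔥.toSubmodule 𝔥s) :
    Module.Dual ℝ 𝔥 →ₗ[ℝ] 𝔡 :=
  sharp B ∘ₗ (Submodule.projectionOnto 𝔥.toSubmodule 𝔥s hc).dualMap

/-- `δ_𝔥 : 𝔥 → 𝔥 ∧ 𝔥`, dual to the `𝔥s`-component of the bracket of `𝔥s`. -/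
def cobracket (B : InvariantPairing 𝔡) (hc : IsCompl 𝔥.toSubmodule 𝔥s) (a : 𝔥)
    (ξ η : Module.Dual ℝ 𝔥) : ℝ :=
  B.form a ⁅toComplement B hc ξ, toComplement B hc η⁆

/-- `φ_𝔥 ∈ ⋀³𝔥`, given by the `𝔥`-component of the bracket of `𝔥s`. -/
def phiSub (B : InvariantPairing 𝔡) (hc : IsCompl 𝔥.toSubmodule 𝔥s)
    (ξ η ζ : Module.Dual ℝ 𝔥) : ℝ :=
  B.form ⁅toComplement B hc ξ, toComplement B hc η⁆ (toComplement B hc ζ)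

/-- The twist `½ ∑ᵢ eᵢ ∧ eⁱ ∈ ⋀²𝔡`, where `eᵢ` is a basis of `𝔥`, `eⁱ` is the dual basis of the
complement `𝔥s`, and `a ∧ b = a ⊗ b - b ⊗ a`. It does not depend on the basis. -/
def twist (B : InvariantPairing 𝔡) (hc : IsCompl 𝔥.toSubmodule 𝔥s) :
    Module.Dual ℝ 𝔡 →ₗ[ℝ] Module.Dual ℝ 𝔡 →ₗ[ℝ] ℝ :=
  let e := Module.finBasis ℝ 𝔥
  let e' := fun i => toComplement B hc (e.coord i)
  (1 / 2 : ℝ) • ∑ i, (tensor (e i : 𝔡) (e' i) - tensor (e' i) (e i : 𝔡))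

end Algebra

/-! ### Tensor fields on a manifold -/

section Fields

variable {E : Type*} [NormedAddCommGroup E] [NormedSpace ℝ E]
  {M : Type*} [TopologicalSpace M] [ChartedSpace E M]

/-- The cotangent space of `M` at `x`. -/
abbrev Cotangent (E : Type*) [NormedAddCommGroup E] [NormedSpace ℝ E] {M : Type*}
    [TopologicalSpace M] [ChartedSpace E M] (x : M) : Type _ :=
  TangentSpace 𝓘(ℝ, E) x →L[ℝ] ℝ

/-- Sections of `TM ⊗ TM` (no smoothness yet), as bilinear forms on the cotangent spaces. -/
abbrev TwoTensor (E : Type*) [NormedAddCommGroup E] [NormedSpace ℝ E] (M : Type*)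
    [TopologicalSpace M] [ChartedSpace E M] : Type _ :=
  Π x : M, Cotangent E x →ₗ[ℝ] Cotangent E x →ₗ[ℝ] ℝ

/-- `f ∈ C^∞(M)`. -/
def IsSmoothFun (E : Type*) [NormedAddCommGroup E] [NormedSpace ℝ E] {M : Type*}
    [TopologicalSpace M] [ChartedSpace E M] (f : M → ℝ) : Prop :=
  ContMDiff 𝓘(ℝ, E) 𝓘(ℝ, ℝ) ∞ f

/-- The differential `df` of a function. -/
abbrev diff (E : Type*) [NormedAddCommGroup E] [NormedSpace ℝ E] {M : Type*}
    [TopologicalSpace M] [ChartedSpace E M] (f : M → ℝ) (x : M) : Cotangent E x :=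
  mvfderiv 𝓘(ℝ, E) f x

/-- `{f, g} = π(df, dg)`. -/
def bracket (π : TwoTensor E M) (f g : M → ℝ) : M → ℝ :=
  fun x => π x (diff E f x) (diff E g x)

/-- A (smooth) bivector field. -/
structure IsBivectorField (π : TwoTensor E M) : Prop where
  alternating : ∀ x α, π x α α = 0
  smooth : ∀ f g : M → ℝ, IsSmoothFun E f → IsSmoothFun E g → IsSmoothFun E (bracket π f g)

/-- Half of the Schouten bracket, `½ [π, π](df, dg, dh)`. The Schouten bracket is normalized as
usual: it is the graded extension of the Lie bracket of vector fields with
`[X₁ ∧ X₂, Y₁ ∧ Y₂] = ∑ᵢⱼ (-1)^(i+j) [Xᵢ, Yⱼ] ∧ X_{3-i} ∧ Y_{3-j}`. -/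
def halfSchouten (π : TwoTensor E M) (f g h : M → ℝ) : M → ℝ := fun x =>
  bracket π f (bracket π g h) x + bracket π g (bracket π h f) x + bracket π h (bracket π f g) x

/-- The Lie derivative `[V, π](df, dg)` of `π` along the vector field `V`. -/
def lieDerivative (V : Π x : M, TangentSpace 𝓘(ℝ, E) x) (π : TwoTensor E M) (f g : M → ℝ) :
    M → ℝ := fun x =>
  diff E (bracket π f g) x (V x)
    - bracket π (fun y => diff E f y (V y)) g x
    - bracket π f (fun y => diff E g y (V y)) x

variable {𝔤 : Type*} [LieRing 𝔤] [LieAlgebra ℝ 𝔤]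

/-- An action of the Lie algebra `𝔤` on `M`: a homomorphism of Lie algebras from `𝔤` to smooth
vector fields on `M`. -/
structure IsAction [IsManifold 𝓘(ℝ, E) ∞ M] (ρ : 𝔤 →ₗ[ℝ] Π x : M, TangentSpace 𝓘(ℝ, E) x) : Prop where
  smooth : ∀ a, ContMDiff 𝓘(ℝ, E) 𝓘(ℝ, E).tangent ∞
    (fun x => (⟨x, ρ a x⟩ : TangentBundle 𝓘(ℝ, E) M))
  lie : ∀ a b, ρ ⁅a, b⁆ = mlieBracket 𝓘(ℝ, E) (ρ a) (ρ b)

/-- The map `ρ_x : 𝔤 → T_x M`. -/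
def actionAt (ρ : 𝔤 →ₗ[ℝ] Π x : M, TangentSpace 𝓘(ℝ, E) x) (x : M) :
    𝔤 →ₗ[ℝ] TangentSpace 𝓘(ℝ, E) x :=
  LinearMap.proj x ∘ₗ ρ

/-- The transpose `ρ_x^* : T_x^* M → 𝔤^*`. -/
def actionDual (ρ : 𝔤 →ₗ[ℝ] Π x : M, TangentSpace 𝓘(ℝ, E) x) (x : M) :
    Cotangent E x →ₗ[ℝ] Module.Dual ℝ 𝔤 where
  toFun α := α.toLinearMap ∘ₗ actionAt ρ x
  map_add' _ _ := rfl
  map_smul' _ _ := rfl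

/-- The section `ρ^{⊗2}(s)` of `TM ⊗ TM` for `s ∈ 𝔤 ⊗ 𝔤`. -/
def pushTwo (ρ : 𝔤 →ₗ[ℝ] Π x : M, TangentSpace 𝓘(ℝ, E) x)
    (s : Module.Dual ℝ 𝔤 →ₗ[ℝ] Module.Dual ℝ 𝔤 →ₗ[ℝ] ℝ) : TwoTensor E M :=
  fun x => s.compl₁₂ (actionDual ρ x) (actionDual ρ x)

/-- Equivariance of a differentiable map for two actions. -/
def IsEquivariant {E' : Type*} [NormedAddCommGroup E'] [NormedSpace ℝ E']
    {N : Type*} [TopologicalSpace N] [ChartedSpace E' N]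
    (ρM : 𝔤 →ₗ[ℝ] Π x : M, TangentSpace 𝓘(ℝ, E) x)
    (ρN : 𝔤 →ₗ[ℝ] Π y : N, TangentSpace 𝓘(ℝ, E') y) (F : M → N) : Prop :=
  ∀ a x, mfderiv 𝓘(ℝ, E) 𝓘(ℝ, E') F x (ρM a x) = ρN a (F x)

end Fields

/-! ### Leaves -/

section Leaves

variable {E : Type*} [NormedAddCommGroup E] [NormedSpace ℝ E]
  {M : Type u} [TopologicalSpace M] [ChartedSpace E M]

/-- A `k`-dimensional manifold `Y` with an injective immersion to `M` is an integral manifold of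
the distribution `D` if its tangent spaces are given by `D`. -/
structure IsIntegralManifold (D : Π x : M, Submodule ℝ (TangentSpace 𝓘(ℝ, E) x)) {k : ℕ}
    {Y : Type u} [TopologicalSpace Y] [ChartedSpace (EuclideanSpace ℝ (Fin k)) Y]
    (j : Y → M) : Prop where
  injective : Function.Injective j
  immersion : IsImmersion (𝓡 k) 𝓘(ℝ, E) ∞ j
  tangent : ∀ y, LinearMap.range (mfderiv (𝓡 k) 𝓘(ℝ, E) j y).toLinearMap = D (j y)

/-- An integral leaf of `D`: a (non-empty) connected integral manifold which contains every
connected integral manifold meeting it. -/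
structure IsLeaf (D : Π x : M, Submodule ℝ (TangentSpace 𝓘(ℝ, E) x)) {k : ℕ}
    {X : Type u} [TopologicalSpace X] [ChartedSpace (EuclideanSpace ℝ (Fin k)) X]
    (ι : X → M) : Prop where
  connected : ConnectedSpace X
  integral : IsIntegralManifold D (k := k) ι
  maximal : ∀ (l : ℕ) (Y : Type u) [TopologicalSpace Y]
    [ChartedSpace (EuclideanSpace ℝ (Fin l)) Y] [IsManifold (𝓡 l) ∞ Y] [ConnectedSpace Y]
    (j : Y → M), IsIntegralManifold D (k := l) j → (range j ∩ range ι).Nonempty → range j ⊆ range ι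

variable {𝔤 : Type*} [LieRing 𝔤] [LieAlgebra ℝ 𝔤]

/-- The stabilizer of an immersed submanifold `ι : X → M`: the elements of `𝔤` which act by vector
fields tangent to `X`. -/
def stabilizer (ρ : 𝔤 →ₗ[ℝ] Π x : M, TangentSpace 𝓘(ℝ, E) x) {k : ℕ}
    {X : Type u} [TopologicalSpace X] [ChartedSpace (EuclideanSpace ℝ (Fin k)) X]
    (ι : X → M) : Submodule ℝ 𝔤 :=
  ⨅ x : X, (LinearMap.range (mfderiv (𝓡 k) 𝓘(ℝ, E) ι x).toLinearMap).comap (actionAt ρ (ι x))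

end Leaves

/-! ### `𝔡`-quasi-Poisson manifolds -/

section QP

variable {𝔡 : Type*} [LieRing 𝔡] [LieAlgebra ℝ 𝔡] [FiniteDimensional ℝ 𝔡]
  {E : Type*} [NormedAddCommGroup E] [NormedSpace ℝ E]
  {M : Type u} [TopologicalSpace M] [ChartedSpace E M] [IsManifold 𝓘(ℝ, E) ∞ M]

/-- `(M, ρ, π)` is a `𝔡`-quasi-Poisson manifold. -/
structure IsQuasiPoisson (B : InvariantPairing 𝔡)
    (ρ : 𝔡 →ₗ[ℝ] Π x : M, TangentSpace 𝓘(ℝ, E) x) (π : TwoTensor E M) : Prop where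
  action : IsAction ρ
  bivector : IsBivectorField π
  invariant : ∀ (a : 𝔡) (f g : M → ℝ), IsSmoothFun E f → IsSmoothFun E g →
    ∀ x, lieDerivative (ρ a) π f g x = 0
  schouten : ∀ f g h : M → ℝ, IsSmoothFun E f → IsSmoothFun E g → IsSmoothFun E h →
    ∀ x, halfSchouten π f g h x =
      phi B (actionDual ρ x (diff E f x)) (actionDual ρ x (diff E g x))
        (actionDual ρ x (diff E h x))

/-- `σ = π + ½ ρ^{⊗2}(t)`. -/
def sigma (B : InvariantPairing 𝔡) (ρ : 𝔡 →ₗ[ℝ] Π x : M, TangentSpace 𝓘(ℝ, E) x)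
    (π : TwoTensor E M) : TwoTensor E M :=
  π + (1 / 2 : ℝ) • pushTwo ρ (tElement B)

/-- `T^L M`, the image of `T^* M → TM`, `α ↦ σ(·, α)`. -/
def leftDistribution (B : InvariantPairing 𝔡) (ρ : 𝔡 →ₗ[ℝ] Π x : M, TangentSpace 𝓘(ℝ, E) x)
    (π : TwoTensor E M) (x : M) : Submodule ℝ (TangentSpace 𝓘(ℝ, E) x) where
  carrier := {v | ∃ α : Cotangent E x, ∀ β : Cotangent E x, β v = sigma B ρ π x β α}
  add_mem' := by
    rintro v w ⟨α, hα⟩ ⟨α', hα'⟩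
    exact ⟨α + α', fun β => by rw [map_add, map_add, hα, hα']⟩
  zero_mem' := ⟨0, fun β => by simp⟩
  smul_mem' := by
    rintro c v ⟨α, hα⟩
    exact ⟨c • α, fun β => by rw [map_smul, map_smul, hα]⟩

/-- `(M, ρ, π)` is split-symplectic: it is quasi-Poisson, `T^{big} M = TM`, i.e. the vectors
`ρ(a) + π(α, ·)` fill the tangent spaces, and the stabilizers of the left leaves are Lagrangian. -/
structure IsSplitSymplectic (B : InvariantPairing 𝔡)
    (ρ : 𝔡 →ₗ[ℝ] Π x : M, TangentSpace 𝓘(ℝ, E) x) (π : TwoTensor E M) : Prop where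
  quasiPoisson : IsQuasiPoisson B ρ π
  big : ∀ (x : M) (v : TangentSpace 𝓘(ℝ, E) x), ∃ (a : 𝔡) (α : Cotangent E x),
    ∀ β : Cotangent E x, β v = β (ρ a x) + π x α β
  lagrangian : ∀ (k : ℕ) (X : Type u) [TopologicalSpace X]
    [ChartedSpace (EuclideanSpace ℝ (Fin k)) X] [IsManifold (𝓡 k) ∞ X] (ι : X → M),
    IsLeaf (leftDistribution B ρ π) (k := k) ι → IsLagrangian B (stabilizer ρ (k := k) ι)

variable {E' : Type*} [NormedAddCommGroup E'] [NormedSpace ℝ E']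
  {N : Type*} [TopologicalSpace N] [ChartedSpace E' N] [IsManifold 𝓘(ℝ, E') ∞ N]

/-- A quasi-Poisson-commutative manifold (with zero bivector field): a `𝔡`-manifold such that the
stabilizers of points are coisotropic. -/
structure IsQuasiPoissonCommutative (B : InvariantPairing 𝔡)
    (ρN : 𝔡 →ₗ[ℝ] Π y : N, TangentSpace 𝓘(ℝ, E') y) : Prop where
  action : IsAction ρN
  coisotropic : ∀ y, IsCoisotropic B (LinearMap.ker (actionAt ρN y))

/-- `f` is right-central: `σ(·, df) = 0`. -/
def IsRightCentralFun (B : InvariantPairing 𝔡) (ρ : 𝔡 →ₗ[ℝ] Π x : M, TangentSpace 𝓘(ℝ, E) x)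
    (π : TwoTensor E M) (f : M → ℝ) : Prop :=
  ∀ (x : M) (α : Cotangent E x), sigma B ρ π x α (diff E f x) = 0

/-- A right-central map from a quasi-Poisson manifold `M` to a quasi-Poisson-commutative `N`. -/
structure IsRightCentralMap (B : InvariantPairing 𝔡)
    (ρ : 𝔡 →ₗ[ℝ] Π x : M, TangentSpace 𝓘(ℝ, E) x) (π : TwoTensor E M)
    (ρN : 𝔡 →ₗ[ℝ] Π y : N, TangentSpace 𝓘(ℝ, E') y) (F : M → N) : Prop where
  commutative : IsQuasiPoissonCommutative B ρN
  smooth : ContMDiff 𝓘(ℝ, E) 𝓘(ℝ, E') ∞ F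
  equivariant : IsEquivariant ρ ρN F
  central : ∀ f : N → ℝ, IsSmoothFun E' f → IsRightCentralFun B ρ π (f ∘ F)

end QP

/-! ### `(𝔥, 𝔡; 𝔥s)`-quasi-Poisson manifolds and moment maps -/

section Manin

variable {𝔡 : Type*} [LieRing 𝔡] [LieAlgebra ℝ 𝔡] [FiniteDimensional ℝ 𝔡]
  {𝔥 : LieSubalgebra ℝ 𝔡} {𝔥s : Submodule ℝ 𝔡}
  {E : Type*} [NormedAddCommGroup E] [NormedSpace ℝ E]
  {X : Type*} [TopologicalSpace X] [ChartedSpace E X] [IsManifold 𝓘(ℝ, E) ∞ X]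

/-- `(X, ρ, π)` is an `(𝔥, 𝔡; 𝔥s)`-quasi-Poisson manifold: `𝔥 ⊆ 𝔡` is a Manin pair, `𝔥s` is a
Lagrangian complement, `½ [π, π] = ρ^{⊗3}(φ_𝔥)`, and `[ρ(a), π] = -ρ^{⊗2}(δ_𝔥(a))` for `a ∈ 𝔥`. -/
structure IsManinQuasiPoisson (B : InvariantPairing 𝔡) (hc : IsCompl 𝔥.toSubmodule 𝔥s)
    (ρ : 𝔥 →ₗ[ℝ] Π x : X, TangentSpace 𝓘(ℝ, E) x) (π : TwoTensor E X) : Prop where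
  lagrangian : IsLagrangian B 𝔥.toSubmodule
  lagrangian_compl : IsLagrangian B 𝔥s
  action : IsAction ρ
  bivector : IsBivectorField π
  schouten : ∀ f g h : X → ℝ, IsSmoothFun E f → IsSmoothFun E g → IsSmoothFun E h →
    ∀ x, halfSchouten π f g h x =
      phiSub B hc (actionDual ρ x (diff E f x)) (actionDual ρ x (diff E g x))
        (actionDual ρ x (diff E h x))
  lie : ∀ (a : 𝔥) (f g : X → ℝ), IsSmoothFun E f → IsSmoothFun E g →
    ∀ x, lieDerivative (ρ a) π f g x =
      -cobracket B hc a (actionDual ρ x (diff E f x)) (actionDual ρ x (diff E g x))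

variable {E' : Type*} [NormedAddCommGroup E'] [NormedSpace ℝ E']
  {N : Type*} [TopologicalSpace N] [ChartedSpace E' N] [IsManifold 𝓘(ℝ, E') ∞ N]

/-- The section `Z_N` of `𝔥 ⊗ TN` with `⟨a, Z_N⟩ = ρ_N(a)` for all `a ∈ 𝔥s`: its contraction with
`ξ` in the dual of `𝔥`, which is identified with `𝔥s`, at the point `y`. -/
def zSection (B : InvariantPairing 𝔡) (hc : IsCompl 𝔥.toSubmodule 𝔥s)
    (ρN : 𝔡 →ₗ[ℝ] Π y : N, TangentSpace 𝓘(ℝ, E') y) (ξ : Module.Dual ℝ 𝔥) (y : N) :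
    TangentSpace 𝓘(ℝ, E') y :=
  ρN (toComplement B hc ξ) y

/-- `μ : X → N` is an `N`-valued moment map on the `(𝔥, 𝔡; 𝔥s)`-quasi-Poisson manifold
`(X, ρ, π)`: `N` is a `𝔡`-manifold with coisotropic stabilizers, `μ` is `𝔥`-equivariant, and
`(1 ⊗ μ_*)(π) = -(ρ ⊗ 1)(Z_N)`. -/
structure IsMomentMap (B : InvariantPairing 𝔡) (hc : IsCompl 𝔥.toSubmodule 𝔥s)
    (ρ : 𝔥 →ₗ[ℝ] Π x : X, TangentSpace 𝓘(ℝ, E) x) (π : TwoTensor E X)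
    (ρN : 𝔡 →ₗ[ℝ] Π y : N, TangentSpace 𝓘(ℝ, E') y) (μ : X → N) : Prop where
  quasiPoisson : IsManinQuasiPoisson B hc ρ π
  action : IsAction ρN
  coisotropic : ∀ y, IsCoisotropic B (LinearMap.ker (actionAt ρN y))
  smooth : ContMDiff 𝓘(ℝ, E) 𝓘(ℝ, E') ∞ μ
  equivariant : IsEquivariant ρ (ρN ∘ₗ 𝔥.toSubmodule.subtype) μ
  moment : ∀ (x : X) (α : Cotangent E x) (β : Cotangent E' (μ x)),
    π x α (β ∘L mfderiv 𝓘(ℝ, E) 𝓘(ℝ, E') μ x) = -β (zSection B hc ρN (actionDual ρ x α) (μ x))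

end Manin

end QuasiPoisson

end

/-! Write `t^♯ ξ = qξ + pξ` with `qξ ∈ 𝔥` and `pξ ∈ 𝔥s` (`subPart`, `complPart`). Since `t = ∑ (eᵢ ⊗
eⁱ + eⁱ ⊗ eᵢ)`, adding `½ t` to the twist leaves `∑ eᵢ ⊗ eⁱ`, and so `π'(α, β) = σ(α, β) -
β(ρ(p(ρ^*α)))` (`sub_pushTwo_twist_apply`). This formula carries the geometry.

If `α` kills `TX`, the first term vanishes because `TX` consists of the vectors `σ(·, β)`, and the
second because `ρ^*α` vanishes on the stabilizer `𝔥`, on which `p` depends only through restriction.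
Thus `π'` is tangent to `X`. If `β = d(f ∘ μ)`, the first term vanishes by centrality, and
equivariance turns the second into the moment map condition.

The two structure equations are proved on `M` and then restricted. When `π` is twisted by
`ρ^{⊗2}(s)`, invariance of `π` makes the mixed terms of the Schouten bracket cancel, leaving an
expression in `𝔡` alone (`IsQuasiPoisson.halfSchouten_sub_pushTwo`), which `phi_add_twist`
evaluates. Likewise the Lie derivative of `π'` only sees the adjoint action on the twist
(`twist_lie`). The results involve only `pξ`, hence only the restriction of `ξ` to `𝔥`, so they make
sense on `X`.

Restriction is possible because an immersion has smooth local left inverses: functions on `X` extend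
locally to `M`, and a vector field related to a smooth one is smooth. -/

noncomputable section

namespace QuasiPoisson

/-! ### Linear algebra of a Lagrangian splitting of `𝔡`. -/

section Algebra

variable {𝔡 : Type*} [LieRing 𝔡] [LieAlgebra ℝ 𝔡]

theorem IsLagrangian.form_eq_zero {B : InvariantPairing 𝔡} {S : Submodule ℝ 𝔡}
    (hS : IsLagrangian B S) {a b : 𝔡} (ha : a ∈ S) (hb : b ∈ S) : B.form a b = 0 := by
  rw [← hS] at hb
  exact hb a ha

theorem IsLagrangian.mem_of_forall {B : InvariantPairing 𝔡} {S : Submodule ℝ 𝔡}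
    (hS : IsLagrangian B S) {b : 𝔡} (hb : ∀ a ∈ S, B.form a b = 0) : b ∈ S := by
  rw [← hS]
  exact hb

variable [FiniteDimensional ℝ 𝔡] (B : InvariantPairing 𝔡)

theorem form_sharp (ξ : Module.Dual ℝ 𝔡) (a : 𝔡) : B.form (sharp B ξ) a = ξ a :=
  LinearMap.BilinForm.apply_toDual_symm_apply ..

theorem form_sharp_right (ξ : Module.Dual ℝ 𝔡) (a : 𝔡) : B.form a (sharp B ξ) = ξ a := by
  rw [B.symm, form_sharp]

variable {𝔥 : LieSubalgebra ℝ 𝔡} {𝔥s : Submodule ℝ 𝔡} (hc : IsCompl 𝔥.toSubmodule 𝔥s)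

theorem form_toComplement (ξ : Module.Dual ℝ 𝔥) (a : 𝔥) :
    B.form (toComplement B hc ξ) a = ξ a := by
  simp only [toComplement, LinearMap.comp_apply, form_sharp, LinearMap.dualMap_apply]
  exact congrArg ξ (Submodule.projectionOnto_apply_left hc a)

theorem toComplement_mem (h𝔥s : IsLagrangian B 𝔥s) (ξ : Module.Dual ℝ 𝔥) :
    toComplement B hc ξ ∈ 𝔥s := by
  refine h𝔥s.mem_of_forall fun a ha => ?_
  simp only [toComplement, LinearMap.comp_apply, form_sharp_right, LinearMap.dualMap_apply]
  rw [(Submodule.projectionOnto_apply_eq_zero_iff hc).2 ha, map_zero]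

/-- The `𝔥s`-component of `t^♯ ξ`. -/
def complPart (ξ : Module.Dual ℝ 𝔡) : 𝔡 :=
  toComplement B hc (ξ ∘ₗ 𝔥.toSubmodule.subtype)

/-- The `𝔥`-component of `t^♯ ξ`. -/
def subPart (ξ : Module.Dual ℝ 𝔡) : 𝔡 := sharp B ξ - complPart B hc ξ

theorem complPart_mem (h𝔥s : IsLagrangian B 𝔥s) (ξ : Module.Dual ℝ 𝔡) :
    complPart B hc ξ ∈ 𝔥s := toComplement_mem B hc h𝔥s _

/-- Both `t^♯ ξ` and its `𝔥s`-part pair with `a ∈ 𝔥` to `ξ(a)`, so their difference lies in `𝔥^⊥ =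
𝔥`. -/
theorem subPart_mem (h𝔥 : IsLagrangian B 𝔥.toSubmodule) (ξ : Module.Dual ℝ 𝔡) :
    subPart B hc ξ ∈ 𝔥 := by
  refine h𝔥.mem_of_forall fun a ha => ?_
  rw [subPart, map_sub, form_sharp_right, B.symm, complPart]
  rw [form_toComplement B hc _ (⟨a, ha⟩ : 𝔥)]
  exact sub_self _

theorem sharp_eq_add (ξ : Module.Dual ℝ 𝔡) :
    sharp B ξ = subPart B hc ξ + complPart B hc ξ := by
  rw [subPart, sub_add_cancel]

theorem apply_eq_form_add (ξ : Module.Dual ℝ 𝔡) (a : 𝔡) :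
    ξ a = B.form (subPart B hc ξ) a + B.form (complPart B hc ξ) a := by
  rw [← form_sharp B, sharp_eq_add B hc, map_add, LinearMap.add_apply]

theorem twist_apply (ξ η : Module.Dual ℝ 𝔡) :
    twist B hc ξ η = (1 / 2) * (η (complPart B hc ξ) - ξ (complPart B hc η)) := by
  -- The expansion `pξ = ∑ ξ(eᵢ) eⁱ`, which removes the basis from the twist.
  have key : ∀ ξ : Module.Dual ℝ 𝔡, complPart B hc ξ =
      ∑ i, ξ (Module.finBasis ℝ 𝔥 i : 𝔥) •
        toComplement B hc ((Module.finBasis ℝ 𝔥).coord i) := by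
    intro ξ
    simp_rw [← map_smul, ← map_sum]
    rw [complPart]
    congr 1
    refine (Module.finBasis ℝ 𝔥).ext fun j => ?_
    simp [LinearMap.sum_apply, Finsupp.single_apply]
    rfl
  rw [key ξ, key η]
  simp [twist, tensor, LinearMap.sum_apply, map_sum, Finset.sum_sub_distrib, mul_comm]

theorem twist_swap (ξ η : Module.Dual ℝ 𝔡) : twist B hc ξ η = -twist B hc η ξ := by
  rw [twist_apply, twist_apply]
  ring

/-- Both sides equal `⟨qξ, pη⟩`, because `𝔥` and `𝔥s` are isotropic. -/
theorem apply_complPart (h𝔥 : IsLagrangian B 𝔥.toSubmodule) (h𝔥s : IsLagrangian B 𝔥s)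
    (ξ η : Module.Dual ℝ 𝔡) :
    ξ (complPart B hc η) = η (subPart B hc ξ) := by
  rw [apply_eq_form_add B hc ξ, apply_eq_form_add B hc η,
    h𝔥s.form_eq_zero (complPart_mem B hc h𝔥s ξ) (complPart_mem B hc h𝔥s η),
    h𝔥.form_eq_zero (subPart_mem B hc h𝔥 η) (subPart_mem B hc h𝔥 ξ), B.symm, add_zero, zero_add]

theorem twist_eq_apply (h𝔥 : IsLagrangian B 𝔥.toSubmodule) (h𝔥s : IsLagrangian B 𝔥s)
    (ξ η : Module.Dual ℝ 𝔡) :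
    twist B hc ξ η = η ((1 / 2 : ℝ) • (complPart B hc ξ - subPart B hc ξ)) := by
  rw [twist_apply, apply_complPart B hc h𝔥 h𝔥s ξ η, map_smul, map_sub, smul_eq_mul]

theorem twist_eq_sub_tElement (h𝔥 : IsLagrangian B 𝔥.toSubmodule) (h𝔥s : IsLagrangian B 𝔥s)
    (ξ η : Module.Dual ℝ 𝔡) :
    twist B hc ξ η = η (complPart B hc ξ) - (1 / 2) * tElement B ξ η := by
  have h : tElement B ξ η = η (complPart B hc ξ) + ξ (complPart B hc η) := by
    rw [apply_complPart B hc h𝔥 h𝔥s ξ η, ← map_add, add_comm, ← sharp_eq_add, tElement,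
      LinearMap.compl₁₂_apply, form_sharp_right]
  rw [h, twist_apply]
  ring

/-- Split each of `ξ, η, ζ` into its `𝔥s`-part (sign `+`) and `𝔥`-part (sign `-`). A component with
signs `a, b, c` gets the coefficient `¼ (1 + ab + bc + ca)`, which is `1` if the signs agree and `0`
otherwise. Of the two surviving terms, the one with all parts in `𝔥` vanishes, as `𝔥` is an
isotropic subalgebra. -/
theorem phi_add_twist (h𝔥 : IsLagrangian B 𝔥.toSubmodule)
    (ξ η ζ : Module.Dual ℝ 𝔡) (J : Module.Dual ℝ 𝔡 → 𝔡)
    (hJ : ∀ ξ, J ξ = (1 / 2 : ℝ) • (complPart B hc ξ - subPart B hc ξ)) :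
    phi B ξ η ζ + (ξ ⁅J η, J ζ⁆ + η ⁅J ζ, J ξ⁆ + ζ ⁅J ξ, J η⁆) =
      B.form ⁅complPart B hc ξ, complPart B hc η⁆ (complPart B hc ζ) := by
  -- By invariance `⟨a, [b, c]⟩` is cyclically symmetric; these two rules bring every term to the
  -- order `ξ, η, ζ`.
  have cyc : ∀ a b c, B.form b ⁅c, a⁆ = B.form a ⁅b, c⁆ := fun a b c => by
    rw [← B.invariant, B.symm]
  have cyc' : ∀ a b c, B.form c ⁅a, b⁆ = B.form a ⁅b, c⁆ := fun a b c => by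
    rw [B.symm, B.invariant]
  have h0 : B.form (subPart B hc ξ) ⁅subPart B hc η, subPart B hc ζ⁆ = 0 :=
    h𝔥.form_eq_zero (subPart_mem B hc h𝔥 ξ)
      (𝔥.lie_mem (subPart_mem B hc h𝔥 η) (subPart_mem B hc h𝔥 ζ))
  simp only [phi, hJ, sharp_eq_add B hc, apply_eq_form_add B hc ξ, apply_eq_form_add B hc η,
    apply_eq_form_add B hc ζ]
  simp only [lie_add, add_lie, lie_sub, sub_lie, lie_smul, smul_lie, map_add, map_sub, map_smul,
    smul_eq_mul, B.invariant]
  generalize subPart B hc ξ = x₁, subPart B hc η = y₁, subPart B hc ζ = z₁,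
    complPart B hc ξ = x₂, complPart B hc η = y₂, complPart B hc ζ = z₂ at *
  simp only [cyc _ y₁, cyc _ y₂, cyc' _ _ z₁, cyc' _ _ z₂, h0]
  ring

theorem tElement_lie (a : 𝔡) (ξ η : Module.Dual ℝ 𝔡) :
    tElement B (ξ ∘ₗ LieAlgebra.ad ℝ 𝔡 a) η + tElement B ξ (η ∘ₗ LieAlgebra.ad ℝ 𝔡 a) = 0 := by
  rw [tElement, LinearMap.compl₁₂_apply, LinearMap.compl₁₂_apply, form_sharp, form_sharp_right,
    LinearMap.comp_apply, LinearMap.comp_apply, LieAlgebra.ad_apply, LieAlgebra.ad_apply,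
    ← form_sharp B ξ, ← form_sharp B η, ← B.invariant, ← lie_skew, map_neg,
    LinearMap.neg_apply, B.symm _ (sharp B η), neg_add_cancel]

/-- The part `½ t` of the twist is invariant, so only `∑ eᵢ ⊗ eⁱ` contributes. Its variation is
`ξ([a, qη]) + η([a, pξ])`: here the `𝔥`–`𝔥` pairing vanishes, the mixed ones cancel, and `⟨pη, [a,
pξ]⟩` remains. -/
theorem twist_lie (h𝔥 : IsLagrangian B 𝔥.toSubmodule) (h𝔥s : IsLagrangian B 𝔥s)
    (a : 𝔥) (ξ η : Module.Dual ℝ 𝔡) :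
    twist B hc (ξ ∘ₗ LieAlgebra.ad ℝ 𝔡 a) η + twist B hc ξ (η ∘ₗ LieAlgebra.ad ℝ 𝔡 a) =
      B.form a ⁅complPart B hc ξ, complPart B hc η⁆ := by
  have ht := tElement_lie B (a : 𝔡) ξ η
  have h0 : B.form (subPart B hc ξ) ⁅(a : 𝔡), subPart B hc η⁆ = 0 :=
    h𝔥.form_eq_zero (subPart_mem B hc h𝔥 ξ) (𝔥.lie_mem a.2 (subPart_mem B hc h𝔥 η))
  rw [twist_eq_sub_tElement B hc h𝔥 h𝔥s, twist_eq_sub_tElement B hc h𝔥 h𝔥s,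
    apply_complPart B hc h𝔥 h𝔥s η]
  simp only [LinearMap.comp_apply, LieAlgebra.ad_apply]
  rw [apply_eq_form_add B hc ξ, apply_eq_form_add B hc η, h0]
  have h1 : B.form (complPart B hc ξ) ⁅(a : 𝔡), subPart B hc η⁆ =
      -B.form (subPart B hc η) ⁅(a : 𝔡), complPart B hc ξ⁆ := by
    rw [← B.invariant, B.symm, ← lie_skew, map_neg]
  have h2 : B.form (complPart B hc η) ⁅(a : 𝔡), complPart B hc ξ⁆ =
      B.form a ⁅complPart B hc ξ, complPart B hc η⁆ := by
    rw [B.symm, B.invariant]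
  linear_combination h1 + h2 - (1 / 2) * ht

end Algebra

/-! ### Functions, covectors and the Lie bracket of vector fields in charts. -/

section Calculus

open scoped Topology

variable {E : Type*} [NormedAddCommGroup E] [NormedSpace ℝ E]
  {M : Type*} [TopologicalSpace M] [ChartedSpace E M]

theorem IsSmoothFun.mdifferentiableAt {f : M → ℝ} (hf : IsSmoothFun E f) (x : M) :
    MDifferentiableAt 𝓘(ℝ, E) 𝓘(ℝ, ℝ) f x :=
  (ContMDiff.mdifferentiable hf (by simp)) x

theorem diff_congr {f g : M → ℝ} {x : M} (h : f =ᶠ[𝓝 x] g) : diff E f x = diff E g x := by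
  simp only [diff, mvfderiv, h.mfderiv_eq]
  rw [h.self_of_nhds]

theorem diff_comp_apply {E' : Type*} [NormedAddCommGroup E'] [NormedSpace ℝ E']
    {N : Type*} [TopologicalSpace N] [ChartedSpace E' N] {f : N → ℝ} {F : M → N} {x : M}
    (hf : MDifferentiableAt 𝓘(ℝ, E') 𝓘(ℝ, ℝ) f (F x))
    (hF : MDifferentiableAt 𝓘(ℝ, E) 𝓘(ℝ, E') F x) :
    diff E (f ∘ F) x = diff E' f (F x) ∘L mfderiv 𝓘(ℝ, E) 𝓘(ℝ, E') F x :=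
  mvfderiv_comp x hf hF

theorem diff_eq_fderiv {f : E → ℝ} {x : E} : diff E f x = fderiv ℝ f x := by
  ext v
  simp [diff, mvfderiv]
  rfl

/-- The derivative of a function along a vector field. -/
def applyField (V : Π x : M, TangentSpace 𝓘(ℝ, E) x) (f : M → ℝ) : M → ℝ :=
  fun y => diff E f y (V y)

variable [IsManifold 𝓘(ℝ, E) ∞ M]

theorem IsSmoothFun.applyField {V : Π x : M, TangentSpace 𝓘(ℝ, E) x}
    (hV : ContMDiff 𝓘(ℝ, E) 𝓘(ℝ, E).tangent ∞ (fun x => (⟨x, V x⟩ : TangentBundle 𝓘(ℝ, E) M)))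
    {f : M → ℝ} (hf : IsSmoothFun E f) : IsSmoothFun E (applyField V f) := by
  have h := (ContMDiff.contMDiff_tangentMap hf (m := ∞) (by simp)).comp hV
  exact (contMDiff_snd_tangentBundle_modelSpace ℝ 𝓘(ℝ, ℝ)).comp h

theorem exists_isSmoothFun_eventuallyEq [FiniteDimensional ℝ E] [T2Space M] {f : M → ℝ} {U : Set M}
    {x : M} (hU : U ∈ 𝓝 x) (hf : ContMDiffOn 𝓘(ℝ, E) 𝓘(ℝ, ℝ) ∞ f U) :
    ∃ F : M → ℝ, IsSmoothFun E F ∧ F =ᶠ[𝓝 x] f := by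
  obtain ⟨φ, -, hφ⟩ := (SmoothBumpFunction.nhds_basis_tsupport (I := 𝓘(ℝ, E)) x).mem_iff.1
    (interior_mem_nhds.2 hU)
  refine ⟨fun y => φ y * f y, ?_, ?_⟩
  · refine contMDiff_of_tsupport fun y hy => ?_
    have hy' : y ∈ tsupport φ := tsupport_mul_subset_left hy
    exact φ.contMDiff.contMDiffAt.mul ((hf.mono interior_subset).contMDiffAt
      (isOpen_interior.mem_nhds (hφ hy')))
  · filter_upwards [φ.eventuallyEq_one] with y hy
    simp [hy]

/-- Compose `α` with the chart at `x`, whose derivative at its centre is the identity, and cut off.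
This turns conditions on differentials of functions into conditions on covectors. -/
theorem exists_diff_eq [FiniteDimensional ℝ E] [T2Space M] (x : M) (α : Cotangent E x) :
    ∃ F : M → ℝ, IsSmoothFun E F ∧ diff E F x = α := by
  let α' : E →L[ℝ] ℝ := α
  obtain ⟨F, hF, hFe⟩ := exists_isSmoothFun_eventuallyEq (E := E) (f := α' ∘ extChartAt 𝓘(ℝ, E) x)
    ((chartAt E x).open_source.mem_nhds (mem_chart_source E x))
    (α'.contMDiff.comp_contMDiffOn contMDiffOn_extChartAt)
  refine ⟨F, hF, ?_⟩
  rw [diff_congr hFe, diff_comp_apply (E' := E)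
    ((α'.contMDiff (n := 1)).contMDiffAt.mdifferentiableAt one_ne_zero)
    (mdifferentiableAt_extChartAt (mem_chart_source E x)), mfderiv_extChartAt_self, diff_eq_fderiv,
    α'.fderiv]
  rfl

/-- A vector field in the chart at `x`. -/
def fieldInChart (V : Π x : M, TangentSpace 𝓘(ℝ, E) x) (x : M) (z : E) : E :=
  mfderiv 𝓘(ℝ, E) 𝓘(ℝ, E) (extChartAt 𝓘(ℝ, E) x) ((extChartAt 𝓘(ℝ, E) x).symm z)
    (V ((extChartAt 𝓘(ℝ, E) x).symm z))

theorem mpullbackWithin_eq_fieldInChart (V : Π x : M, TangentSpace 𝓘(ℝ, E) x) (x : M) {z : E}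
    (hz : z ∈ (extChartAt 𝓘(ℝ, E) x).target) :
    mpullbackWithin 𝓘(ℝ, E) 𝓘(ℝ, E) (extChartAt 𝓘(ℝ, E) x).symm V (range 𝓘(ℝ, E)) z =
      fieldInChart V x z := by
  rw [mpullbackWithin_apply, ContinuousLinearMap.inverse_eq
    (mfderivWithin_extChartAt_symm_comp_mfderiv_extChartAt hz)
    (mfderiv_extChartAt_comp_mfderivWithin_extChartAt_symm hz)]
  rfl

theorem fieldInChart_self (V : Π x : M, TangentSpace 𝓘(ℝ, E) x) (x : M) :
    fieldInChart V x (extChartAt 𝓘(ℝ, E) x x) = V x := by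
  rw [fieldInChart, extChartAt_to_inv, mfderiv_extChartAt_self]
  rfl

theorem differentiableAt_fieldInChart [CompleteSpace E] {V : Π x : M, TangentSpace 𝓘(ℝ, E) x}
    (hV : ContMDiff 𝓘(ℝ, E) 𝓘(ℝ, E).tangent ∞ (fun x => (⟨x, V x⟩ : TangentBundle 𝓘(ℝ, E) M)))
    (x : M) : DifferentiableAt ℝ (fieldInChart V x) (extChartAt 𝓘(ℝ, E) x x) := by
  have : IsManifold 𝓘(ℝ, E) 2 M := IsManifold.of_le (n := ∞)
    (WithTop.coe_le_coe.2 (le_top : (2 : ℕ∞) ≤ ⊤))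
  have h : DifferentiableWithinAt ℝ (F := E)
      (mpullbackWithin 𝓘(ℝ, E) 𝓘(ℝ, E) (extChartAt 𝓘(ℝ, E) x).symm V (range 𝓘(ℝ, E)))
      ((extChartAt 𝓘(ℝ, E) x).symm ⁻¹' univ ∩ range 𝓘(ℝ, E)) (extChartAt 𝓘(ℝ, E) x x) :=
    (((hV.mdifferentiable (by simp)) x).mdifferentiableWithinAt
      (s := univ)).differentiableWithinAt_mpullbackWithin_vectorField
  refine (h.differentiableAt (by simp)).congr_of_eventuallyEq ?_
  filter_upwards [extChartAt_target_mem_nhds (I := 𝓘(ℝ, E)) x] with z hz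
  exact (mpullbackWithin_eq_fieldInChart V x hz).symm

theorem mlieBracket_eq_lieBracket (V W : Π x : M, TangentSpace 𝓘(ℝ, E) x) (x : M) :
    mlieBracket 𝓘(ℝ, E) V W x =
      lieBracket ℝ (fieldInChart V x) (fieldInChart W x) (extChartAt 𝓘(ℝ, E) x x) := by
  -- `mlieBracket` pulls the bracket in the chart back by the inverse of the chart's derivative at
  -- its own centre, which is the identity.
  have hinv : ∀ L : E →L[ℝ] E, L = ContinuousLinearMap.id ℝ E → ∀ u v : E, u = v →
      L.inverse u = v := by
    rintro L rfl u v rfl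
    rw [ContinuousLinearMap.inverse_id, ContinuousLinearMap.id_apply]
  have h : ∀ V : Π x : M, TangentSpace 𝓘(ℝ, E) x,
      (mpullbackWithin 𝓘(ℝ, E) 𝓘(ℝ, E) (extChartAt 𝓘(ℝ, E) x).symm V (range 𝓘(ℝ, E)) : E → E)
        =ᶠ[𝓝 (extChartAt 𝓘(ℝ, E) x x)] fieldInChart V x := fun V => by
    filter_upwards [extChartAt_target_mem_nhds (I := 𝓘(ℝ, E)) x] with z hz
    exact mpullbackWithin_eq_fieldInChart V x hz
  have hbr : ∀ (V₁ W₁ V₂ W₂ : E → E) (t : Set E) (z : E), t = univ → V₁ =ᶠ[𝓝 z] V₂ →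
      W₁ =ᶠ[𝓝 z] W₂ → lieBracketWithin ℝ V₁ W₁ t z = lieBracket ℝ V₂ W₂ z := by
    rintro V₁ W₁ V₂ W₂ t z rfl hV hW
    rw [lieBracketWithin_univ, hV.lieBracket_vectorField_eq hW]
  exact hinv _ mfderiv_extChartAt_self _ _ (hbr _ _ _ _ _ _ (by simp) (h V) (h W))

theorem diff_eq_fderiv_inChart {f : M → ℝ} (hf : IsSmoothFun E f) (x : M) {z : E}
    (hz : z ∈ (extChartAt 𝓘(ℝ, E) x).target)
    (v : TangentSpace 𝓘(ℝ, E) ((extChartAt 𝓘(ℝ, E) x).symm z)) :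
    diff E f ((extChartAt 𝓘(ℝ, E) x).symm z) v =
      fderiv ℝ (f ∘ (extChartAt 𝓘(ℝ, E) x).symm) z
        (mfderiv 𝓘(ℝ, E) 𝓘(ℝ, E) (extChartAt 𝓘(ℝ, E) x) ((extChartAt 𝓘(ℝ, E) x).symm z) v) := by
  have hs : MDifferentiableAt 𝓘(ℝ, E) 𝓘(ℝ, E) (extChartAt 𝓘(ℝ, E) x).symm z := by
    have := mdifferentiableWithinAt_extChartAt_symm hz
    rwa [ModelWithCorners.range_eq_univ, mdifferentiableWithinAt_univ] at this
  have h := mfderivWithin_extChartAt_symm_comp_mfderiv_extChartAt hz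
  rw [ModelWithCorners.range_eq_univ, mfderivWithin_univ] at h
  rw [← diff_eq_fderiv, diff_comp_apply (hf.mdifferentiableAt _) hs]
  exact congrArg (diff E f _) (congrArg (fun L => L v) h).symm

theorem contDiffAt_inChart {f : M → ℝ} (hf : IsSmoothFun E f) (x : M) :
    ContDiffAt ℝ ∞ (f ∘ (extChartAt 𝓘(ℝ, E) x).symm) (extChartAt 𝓘(ℝ, E) x x) :=
  ((ContMDiff.comp_contMDiffOn hf (contMDiffOn_extChartAt_symm x)).contMDiffAt
    (extChartAt_target_mem_nhds x)).contDiffAt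

theorem diff_eq_fderiv_center {f : M → ℝ} (hf : IsSmoothFun E f) (x : M)
    (v : TangentSpace 𝓘(ℝ, E) x) :
    diff E f x v =
      fderiv ℝ (f ∘ (extChartAt 𝓘(ℝ, E) x).symm) (extChartAt 𝓘(ℝ, E) x x) v := by
  have h : f =ᶠ[𝓝 x] (f ∘ (extChartAt 𝓘(ℝ, E) x).symm) ∘ extChartAt 𝓘(ℝ, E) x := by
    filter_upwards [extChartAt_source_mem_nhds (I := 𝓘(ℝ, E)) x] with y hy
    simp only [Function.comp_apply, (extChartAt 𝓘(ℝ, E) x).left_inv hy]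
  rw [diff_congr h, diff_comp_apply
    ((contDiffAt_inChart hf x).differentiableAt (by simp)).mdifferentiableAt
    (mdifferentiableAt_extChartAt (mem_chart_source E x)), mfderiv_extChartAt_self, diff_eq_fderiv]
  rfl

/-- The product rule for `z ↦ Dg(z)(V(z))` in the chart. It isolates the second-derivative term, the
one that must cancel in a commutator. -/
theorem diff_applyField_eq [CompleteSpace E] {V : Π x : M, TangentSpace 𝓘(ℝ, E) x}
    (hV : ContMDiff 𝓘(ℝ, E) 𝓘(ℝ, E).tangent ∞ (fun x => (⟨x, V x⟩ : TangentBundle 𝓘(ℝ, E) M)))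
    {f : M → ℝ} (hf : IsSmoothFun E f) (x : M) (w : TangentSpace 𝓘(ℝ, E) x) :
    diff E (applyField V f) x w =
      fderiv ℝ (fderiv ℝ (f ∘ (extChartAt 𝓘(ℝ, E) x).symm)) (extChartAt 𝓘(ℝ, E) x x) w (V x) +
      fderiv ℝ (f ∘ (extChartAt 𝓘(ℝ, E) x).symm) (extChartAt 𝓘(ℝ, E) x x)
        (fderiv ℝ (fieldInChart V x) (extChartAt 𝓘(ℝ, E) x x) w) := by
  set φ := extChartAt 𝓘(ℝ, E) x with hφ
  set g : E → ℝ := f ∘ φ.symm with hg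
  have hgs : ContDiffAt ℝ ∞ g (φ x) := contDiffAt_inChart hf x
  have hg' : DifferentiableAt ℝ (fderiv ℝ g) (φ x) :=
    (hgs.fderiv_right (m := 1) (WithTop.coe_le_coe.2 (le_top : (2 : ℕ∞) ≤ ⊤))).differentiableAt one_ne_zero
  have hsymm : φ.symm (φ x) = x := extChartAt_to_inv x
  let G : E → ℝ := fun z => fderiv ℝ g z (fieldInChart V x z)
  have hG : applyField V f =ᶠ[𝓝 x] G ∘ φ := by
    filter_upwards [extChartAt_source_mem_nhds (I := 𝓘(ℝ, E)) x] with y hy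
    have h2 := diff_eq_fderiv_inChart hf x (φ.map_source hy) (V (φ.symm (φ y)))
    simp only [Function.comp_apply, G, fieldInChart]
    rw [← hφ, ← h2, φ.left_inv hy, applyField]
  have hGd : HasFDerivAt G _ (φ x) := hg'.hasFDerivAt.clm_apply
    (differentiableAt_fieldInChart hV x).hasFDerivAt
  rw [diff_congr hG, diff_comp_apply hGd.differentiableAt.mdifferentiableAt
    (mdifferentiableAt_extChartAt (mem_chart_source E x)), mfderiv_extChartAt_self, diff_eq_fderiv,
    hGd.fderiv, fieldInChart_self]
  exact add_comm _ _

/-- A vector field acts on functions by derivations, and the Lie bracket by the commutator. -/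
theorem diff_mlieBracket [CompleteSpace E] {V W : Π x : M, TangentSpace 𝓘(ℝ, E) x}
    (hV : ContMDiff 𝓘(ℝ, E) 𝓘(ℝ, E).tangent ∞ (fun x => (⟨x, V x⟩ : TangentBundle 𝓘(ℝ, E) M)))
    (hW : ContMDiff 𝓘(ℝ, E) 𝓘(ℝ, E).tangent ∞ (fun x => (⟨x, W x⟩ : TangentBundle 𝓘(ℝ, E) M)))
    {f : M → ℝ} (hf : IsSmoothFun E f) (x : M) :
    diff E f x (mlieBracket 𝓘(ℝ, E) V W x) =
      diff E (applyField W f) x (V x) - diff E (applyField V f) x (W x) := by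
  rw [diff_applyField_eq hV hf, diff_applyField_eq hW hf, diff_eq_fderiv_center hf,
    mlieBracket_eq_lieBracket, lieBracket, fieldInChart_self, fieldInChart_self, map_sub]
  -- Symmetry of the second derivative is what remains once the first-order terms are matched with
  -- the bracket.
  have hsymm : IsSymmSndFDerivAt ℝ (f ∘ (extChartAt 𝓘(ℝ, E) x).symm) (extChartAt 𝓘(ℝ, E) x x) :=
    (contDiffAt_inChart hf x).isSymmSndFDerivAt
      (by simpa using WithTop.coe_le_coe.2 (le_top : (2 : ℕ∞) ≤ ⊤))
  have h := hsymm.eq (V x) (W x)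
  linear_combination -h

end Calculus

theorem bilin_dual_eq_sum {V : Type*} [AddCommGroup V] [Module ℝ V] [FiniteDimensional ℝ V]
    (s : Module.Dual ℝ V →ₗ[ℝ] Module.Dual ℝ V →ₗ[ℝ] ℝ) (ξ η : Module.Dual ℝ V) :
    s ξ η = ∑ i, ∑ j, s ((Module.finBasis ℝ V).coord i) ((Module.finBasis ℝ V).coord j) *
      (ξ (Module.finBasis ℝ V i) * η (Module.finBasis ℝ V j)) := by
  have h : ∀ ξ : Module.Dual ℝ V, ξ = ∑ i, ξ (Module.finBasis ℝ V i) •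
      (Module.finBasis ℝ V).coord i := fun ξ => by
    refine (Module.finBasis ℝ V).ext fun j => ?_
    simp
  conv_lhs => rw [h ξ, h η]
  simp only [map_sum, map_smul, LinearMap.sum_apply, LinearMap.smul_apply, smul_eq_mul,
    Finset.mul_sum]
  rw [Finset.sum_comm]
  refine Finset.sum_congr rfl fun i _ => Finset.sum_congr rfl fun j _ => ?_
  ring

/-! ### Calculus of the tensor fields `ρ^{⊗2}(s)`. -/

section PushForward

variable {E : Type*} [NormedAddCommGroup E] [NormedSpace ℝ E]
  {M : Type*} [TopologicalSpace M] [ChartedSpace E M]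

theorem IsSmoothFun.sub {f g : M → ℝ} (hf : IsSmoothFun E f) (hg : IsSmoothFun E g) :
    IsSmoothFun E (f - g) := ContMDiff.sub hf hg

theorem IsSmoothFun.mul {f g : M → ℝ} (hf : IsSmoothFun E f) (hg : IsSmoothFun E g) :
    IsSmoothFun E (f * g) := ContMDiff.mul hf hg

theorem IsSmoothFun.const (c : ℝ) : IsSmoothFun E (fun _ : M => c) := contMDiff_const

theorem IsSmoothFun.sum {κ : Type*} {s : Finset κ} {f : κ → M → ℝ}
    (hf : ∀ i ∈ s, IsSmoothFun E (f i)) : IsSmoothFun E (∑ i ∈ s, f i) :=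
  contMDiff_finsetSum' hf

theorem diff_add {f g : M → ℝ} (hf : IsSmoothFun E f) (hg : IsSmoothFun E g) (x : M) :
    diff E (f + g) x = diff E f x + diff E g x :=
  mvfderiv_add (hf.mdifferentiableAt x) (hg.mdifferentiableAt x)

theorem diff_sub {f g : M → ℝ} (hf : IsSmoothFun E f) (hg : IsSmoothFun E g) (x : M) :
    diff E (f - g) x = diff E f x - diff E g x :=
  mvfderiv_sub (hf.mdifferentiableAt x) (hg.mdifferentiableAt x)

theorem diff_mul {f g : M → ℝ} (hf : IsSmoothFun E f) (hg : IsSmoothFun E g) (x : M) :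
    diff E (f * g) x = f x • diff E g x + g x • diff E f x :=
  mvfderiv_mul (hf.mdifferentiableAt x) (hg.mdifferentiableAt x)

theorem diff_const_mul (c : ℝ) {f : M → ℝ} (hf : IsSmoothFun E f) (x : M) :
    diff E ((fun _ => c) * f) x = c • diff E f x := by
  rw [diff_mul (IsSmoothFun.const c) hf]
  have : diff E (fun _ : M => c) x = 0 := mvfderiv_const c
  rw [this, smul_zero, add_zero]

theorem diff_sum {κ : Type*} {s : Finset κ} {f : κ → M → ℝ}
    (hf : ∀ i ∈ s, IsSmoothFun E (f i)) (x : M) :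
    diff E (∑ i ∈ s, f i) x = ∑ i ∈ s, diff E (f i) x := by
  classical
  induction s using Finset.induction_on with
  | empty => simp
  | insert i s hi ih =>
    have hs : ∀ j ∈ s, IsSmoothFun E (f j) := fun j hj => hf j (Finset.mem_insert_of_mem hj)
    rw [Finset.sum_insert hi, Finset.sum_insert hi,
      diff_add (hf i (Finset.mem_insert_self i s)) (IsSmoothFun.sum hs), ih hs]

variable {𝔤 : Type*} [LieRing 𝔤] [LieAlgebra ℝ 𝔤]
  {ρ : 𝔤 →ₗ[ℝ] Π x : M, TangentSpace 𝓘(ℝ, E) x}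

theorem bracket_pushTwo_eq_sum [FiniteDimensional ℝ 𝔤]
    (s : Module.Dual ℝ 𝔤 →ₗ[ℝ] Module.Dual ℝ 𝔤 →ₗ[ℝ] ℝ)
    (f g : M → ℝ) :
    bracket (pushTwo ρ s) f g = ∑ i, ∑ j,
      (fun _ => s ((Module.finBasis ℝ 𝔤).coord i) ((Module.finBasis ℝ 𝔤).coord j)) *
        (applyField (ρ (Module.finBasis ℝ 𝔤 i)) f * applyField (ρ (Module.finBasis ℝ 𝔤 j)) g) := by
  funext y
  simp only [Finset.sum_apply, Pi.mul_apply]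
  exact bilin_dual_eq_sum s _ _

variable [IsManifold 𝓘(ℝ, E) ∞ M]

/-- The linear map `a ↦ d(ρ(a) f)`. -/
def diffAction (hρ : IsAction ρ) {f : M → ℝ} (hf : IsSmoothFun E f) (x : M) :
    𝔤 →ₗ[ℝ] Cotangent E x where
  toFun a := diff E (applyField (ρ a) f) x
  map_add' a b := by
    rw [← diff_add (hf.applyField (hρ.smooth a)) (hf.applyField (hρ.smooth b))]
    congr 1
    funext y
    simp [applyField]
  map_smul' c a := by
    rw [RingHom.id_apply, ← diff_const_mul c (hf.applyField (hρ.smooth a))]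
    congr 1
    funext y
    simp [applyField]

theorem diffAction_apply (hρ : IsAction ρ) {f : M → ℝ} (hf : IsSmoothFun E f) (x : M) (a : 𝔤) :
    diffAction hρ hf x a = diff E (applyField (ρ a) f) x := rfl

/-- The left side is the commutator of `ρ(b)` and `ρ(a)` applied to `f`. This is how second
derivatives of functions turn into brackets in `𝔤`. -/
theorem diffAction_sub [CompleteSpace E] (hρ : IsAction ρ) {f : M → ℝ} (hf : IsSmoothFun E f)
    (x : M) (a b : 𝔤) :
    diffAction hρ hf x a (ρ b x) - diffAction hρ hf x b (ρ a x) =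
      actionDual ρ x (diff E f x) ⁅b, a⁆ := by
  have h : actionDual ρ x (diff E f x) ⁅b, a⁆ = diff E f x (ρ ⁅b, a⁆ x) := rfl
  rw [h, hρ.lie, diff_mlieBracket (hρ.smooth b) (hρ.smooth a) hf]
  rfl

variable [FiniteDimensional ℝ 𝔤]

theorem isSmoothFun_bracket_pushTwo (hρ : IsAction ρ)
    (s : Module.Dual ℝ 𝔤 →ₗ[ℝ] Module.Dual ℝ 𝔤 →ₗ[ℝ] ℝ) {f g : M → ℝ}
    (hf : IsSmoothFun E f) (hg : IsSmoothFun E g) :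
    IsSmoothFun E (bracket (pushTwo ρ s) f g) := by
  rw [bracket_pushTwo_eq_sum]
  exact IsSmoothFun.sum fun i _ => IsSmoothFun.sum fun j _ => (IsSmoothFun.const _).mul
    ((hf.applyField (hρ.smooth _)).mul (hg.applyField (hρ.smooth _)))

/-- The Leibniz rule for `ρ^{⊗2}(s)(df, dg)`. -/
theorem apply_diff_bracket_pushTwo (hρ : IsAction ρ)
    (s : Module.Dual ℝ 𝔤 →ₗ[ℝ] Module.Dual ℝ 𝔤 →ₗ[ℝ] ℝ) {f g : M → ℝ}
    (hf : IsSmoothFun E f) (hg : IsSmoothFun E g) (x : M) (Λ : Cotangent E x →ₗ[ℝ] ℝ) :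
    Λ (diff E (bracket (pushTwo ρ s) f g) x) =
      s (Λ ∘ₗ diffAction hρ hf x) (actionDual ρ x (diff E g x)) +
      s (actionDual ρ x (diff E f x)) (Λ ∘ₗ diffAction hρ hg x) := by
  have hij : ∀ i j, IsSmoothFun E
      ((fun _ => s ((Module.finBasis ℝ 𝔤).coord i) ((Module.finBasis ℝ 𝔤).coord j)) *
        (applyField (ρ (Module.finBasis ℝ 𝔤 i)) f * applyField (ρ (Module.finBasis ℝ 𝔤 j)) g)) :=
    fun i j => (IsSmoothFun.const _).mul
      ((hf.applyField (hρ.smooth _)).mul (hg.applyField (hρ.smooth _)))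
  rw [bracket_pushTwo_eq_sum, diff_sum fun i _ => IsSmoothFun.sum fun j _ => hij i j, map_sum,
    bilin_dual_eq_sum s, bilin_dual_eq_sum s, ← Finset.sum_add_distrib]
  refine Finset.sum_congr rfl fun i _ => ?_
  rw [diff_sum fun j _ => hij i j, map_sum, ← Finset.sum_add_distrib]
  refine Finset.sum_congr rfl fun j _ => ?_
  rw [diff_const_mul _ ((hf.applyField (hρ.smooth _)).mul (hg.applyField (hρ.smooth _))),
    diff_mul (hf.applyField (hρ.smooth _)) (hg.applyField (hρ.smooth _)), map_smul, map_add,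
    map_smul, map_smul]
  change _ * (actionDual ρ x (diff E f x) _ * Λ _ + actionDual ρ x (diff E g x) _ * Λ _) =
    _ * (Λ _ * _) + _ * (_ * Λ _)
  simp only [diffAction_apply]
  ring

end PushForward

/-! ### Twisting a quasi-Poisson bivector field by an element of `⋀²𝔡`. -/

section Twist

variable {𝔡 : Type*} [LieRing 𝔡] [LieAlgebra ℝ 𝔡] [FiniteDimensional ℝ 𝔡] {B : InvariantPairing 𝔡}
  {E : Type*} [NormedAddCommGroup E] [NormedSpace ℝ E]
  {M : Type u} [TopologicalSpace M] [ChartedSpace E M]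
  {ρ : 𝔡 →ₗ[ℝ] Π x : M, TangentSpace 𝓘(ℝ, E) x} {π : TwoTensor E M}

theorem IsBivectorField.swap (hπ : IsBivectorField π) (x : M) (α β : Cotangent E x) :
    π x α β = -π x β α := by
  have h := hπ.alternating x (α + β)
  rw [map_add, map_add, LinearMap.add_apply, LinearMap.add_apply, hπ.alternating,
    hπ.alternating] at h
  linear_combination h

theorem bracket_sub (π' : TwoTensor E M) (f g : M → ℝ) :
    bracket (π - π') f g = bracket π f g - bracket π' f g := rfl

variable [IsManifold 𝓘(ℝ, E) ∞ M]

theorem IsBivectorField.sub_pushTwo (hπ : IsBivectorField π) (hρ : IsAction ρ)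
    {s : Module.Dual ℝ 𝔡 →ₗ[ℝ] Module.Dual ℝ 𝔡 →ₗ[ℝ] ℝ} (hs : ∀ ξ η, s ξ η = -s η ξ) :
    IsBivectorField (π - pushTwo ρ s) where
  alternating x α := by
    have h : pushTwo ρ s x α α = 0 := by
      have := hs (actionDual ρ x α) (actionDual ρ x α)
      exact (by linarith : s (actionDual ρ x α) (actionDual ρ x α) = 0)
    exact (congrArg₂ (· - ·) (hπ.alternating x α) h).trans (sub_zero 0)
  smooth f g hf hg := by
    rw [bracket_sub]
    exact (hπ.smooth f g hf hg).sub (isSmoothFun_bracket_pushTwo hρ s hf hg)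

theorem IsQuasiPoisson.bracket_bracket_pushTwo (hM : IsQuasiPoisson B ρ π)
    (s : Module.Dual ℝ 𝔡 →ₗ[ℝ] Module.Dual ℝ 𝔡 →ₗ[ℝ] ℝ) {f g h : M → ℝ}
    (hg : IsSmoothFun E g) (hh : IsSmoothFun E h) (x : M) :
    bracket π f (bracket (pushTwo ρ s) g h) x =
      s (π x (diff E f x) ∘ₗ diffAction hM.action hg x) (actionDual ρ x (diff E h x)) +
      s (actionDual ρ x (diff E g x)) (π x (diff E f x) ∘ₗ diffAction hM.action hh x) :=
  apply_diff_bracket_pushTwo hM.action s hg hh x (π x (diff E f x))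

/-- Invariance of `π` says that `ρ(a)` is a derivation of the bracket: `ρ(a){g, h} = {ρ(a)g, h} +
{g, ρ(a)h}`. -/
theorem IsQuasiPoisson.actionDual_diff_bracket (hM : IsQuasiPoisson B ρ π) {g h : M → ℝ}
    (hg : IsSmoothFun E g) (hh : IsSmoothFun E h) (x : M) :
    actionDual ρ x (diff E (bracket π g h) x) =
      π x (diff E g x) ∘ₗ diffAction hM.action hh x -
        π x (diff E h x) ∘ₗ diffAction hM.action hg x := by
  ext a
  have h1 := hM.invariant a g h hg hh x
  have h2 : π x (diff E (applyField (ρ a) g) x) (diff E h x) =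
    -π x (diff E h x) (diff E (applyField (ρ a) g) x) := hM.bivector.swap x _ _
  change diff E (bracket π g h) x (ρ a x) - π x (diff E (applyField (ρ a) g) x) (diff E h x) -
    π x (diff E g x) (diff E (applyField (ρ a) h) x) = 0 at h1
  change diff E (bracket π g h) x (ρ a x) = π x (diff E g x) (diff E (applyField (ρ a) h) x) -
    π x (diff E h x) (diff E (applyField (ρ a) g) x)
  linear_combination h1 + h2

theorem bracket_pushTwo_bracket_pushTwo (hρ : IsAction ρ)
    {s : Module.Dual ℝ 𝔡 →ₗ[ℝ] Module.Dual ℝ 𝔡 →ₗ[ℝ] ℝ} (hs : ∀ ξ η, s ξ η = -s η ξ)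
    {J : Module.Dual ℝ 𝔡 → 𝔡} (hJ : ∀ ξ η, s ξ η = η (J ξ)) {f g h : M → ℝ}
    (hg : IsSmoothFun E g) (hh : IsSmoothFun E h) (x : M) :
    bracket (pushTwo ρ s) f (bracket (pushTwo ρ s) g h) x =
      diffAction hρ hh x (J (actionDual ρ x (diff E g x)))
          (ρ (J (actionDual ρ x (diff E f x))) x) -
        diffAction hρ hg x (J (actionDual ρ x (diff E h x)))
          (ρ (J (actionDual ρ x (diff E f x))) x) := by
  have h1 : bracket (pushTwo ρ s) f (bracket (pushTwo ρ s) g h) x =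
      diff E (bracket (pushTwo ρ s) g h) x (ρ (J (actionDual ρ x (diff E f x))) x) :=
    hJ (actionDual ρ x (diff E f x)) _
  let Λ : Cotangent E x →ₗ[ℝ] ℝ :=
    { toFun := fun α => α (ρ (J (actionDual ρ x (diff E f x))) x)
      map_add' := fun _ _ => rfl
      map_smul' := fun _ _ => rfl }
  have h2 := apply_diff_bracket_pushTwo hρ s hg hh x Λ
  rw [hs (Λ ∘ₗ _), hJ, hJ] at h2
  rw [h1]
  refine h2.trans ?_
  rw [neg_add_eq_sub]
  rfl

theorem IsQuasiPoisson.halfSchouten_sub_pushTwo [CompleteSpace E] (hM : IsQuasiPoisson B ρ π)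
    {s : Module.Dual ℝ 𝔡 →ₗ[ℝ] Module.Dual ℝ 𝔡 →ₗ[ℝ] ℝ} (hs : ∀ ξ η, s ξ η = -s η ξ)
    {J : Module.Dual ℝ 𝔡 → 𝔡} (hJ : ∀ ξ η, s ξ η = η (J ξ)) {f g h : M → ℝ}
    (hf : IsSmoothFun E f) (hg : IsSmoothFun E g) (hh : IsSmoothFun E h) (x : M) :
    let ξ := actionDual ρ x (diff E f x)
    let η := actionDual ρ x (diff E g x)
    let ζ := actionDual ρ x (diff E h x)
    halfSchouten (π - pushTwo ρ s) f g h x =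
      phi B ξ η ζ + (ξ ⁅J η, J ζ⁆ + η ⁅J ζ, J ξ⁆ + ζ ⁅J ξ, J η⁆) := by
  intro ξ η ζ
  -- The four terms are of type `ππ`, `πs`, `sπ`, `ss`. In the cyclic sum the `ππ` terms give `φ`,
  -- the mixed ones cancel by invariance of `π` and skewness of `s`, and the `ss` terms pair up into
  -- the commutators `c1`, `c2`, `c3`.
  have expand : ∀ {f g h : M → ℝ}, IsSmoothFun E g → IsSmoothFun E h →
      bracket (π - pushTwo ρ s) f (bracket (π - pushTwo ρ s) g h) x =
        bracket π f (bracket π g h) x - bracket π f (bracket (pushTwo ρ s) g h) x -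
        s (actionDual ρ x (diff E f x)) (actionDual ρ x (diff E (bracket π g h) x)) +
        bracket (pushTwo ρ s) f (bracket (pushTwo ρ s) g h) x := by
    intro f g h hg hh
    have h1 : diff E (bracket (π - pushTwo ρ s) g h) x =
        diff E (bracket π g h) x - diff E (bracket (pushTwo ρ s) g h) x := by
      rw [bracket_sub, diff_sub (hM.bivector.smooth g h hg hh)
        (isSmoothFun_bracket_pushTwo hM.action s hg hh)]
    rw [bracket_sub, Pi.sub_apply, bracket, bracket, h1, map_sub, map_sub]
    change _ - _ - (s _ _ - bracket (pushTwo ρ s) f (bracket (pushTwo ρ s) g h) x) = _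
    simp only [bracket]
    ring
  have hsch := hM.schouten f g h hf hg hh x
  have c1 := diffAction_sub hM.action hf x (J ζ) (J η)
  have c2 := diffAction_sub hM.action hg x (J ξ) (J ζ)
  have c3 := diffAction_sub hM.action hh x (J η) (J ξ)
  rw [halfSchouten] at hsch ⊢
  rw [expand hg hh, expand hh hf, expand hf hg,
    hM.bracket_bracket_pushTwo s hg hh, hM.bracket_bracket_pushTwo s hh hf,
    hM.bracket_bracket_pushTwo s hf hg, hM.actionDual_diff_bracket hg hh,
    hM.actionDual_diff_bracket hh hf, hM.actionDual_diff_bracket hf hg,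
    bracket_pushTwo_bracket_pushTwo hM.action hs hJ hg hh,
    bracket_pushTwo_bracket_pushTwo hM.action hs hJ hh hf,
    bracket_pushTwo_bracket_pushTwo hM.action hs hJ hf hg]
  simp only [map_sub]
  rw [hs (_ ∘ₗ _), hs (_ ∘ₗ _) (actionDual ρ x (diff E f x)),
    hs (_ ∘ₗ _) (actionDual ρ x (diff E g x))]
  linear_combination hsch + c1 + c2 + c3

theorem lieDerivative_pushTwo [CompleteSpace E] (hρ : IsAction ρ)
    (s : Module.Dual ℝ 𝔡 →ₗ[ℝ] Module.Dual ℝ 𝔡 →ₗ[ℝ] ℝ) (a : 𝔡) {f g : M → ℝ}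
    (hf : IsSmoothFun E f) (hg : IsSmoothFun E g) (x : M) :
    lieDerivative (ρ a) (pushTwo ρ s) f g x =
      s (actionDual ρ x (diff E f x) ∘ₗ LieAlgebra.ad ℝ 𝔡 a) (actionDual ρ x (diff E g x)) +
      s (actionDual ρ x (diff E f x)) (actionDual ρ x (diff E g x) ∘ₗ LieAlgebra.ad ℝ 𝔡 a) := by
  let Λ : Cotangent E x →ₗ[ℝ] ℝ :=
    { toFun := fun α => α (ρ a x)
      map_add' := fun _ _ => rfl
      map_smul' := fun _ _ => rfl }
  -- The covector `ρ^*df` composed with `ad a` is the difference between differentiating `b ↦ ρ(b)f`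
  -- along `ρ(a)` and the pullback of `d(ρ(a)f)`.
  have had : ∀ {f : M → ℝ} (hf : IsSmoothFun E f),
      actionDual ρ x (diff E f x) ∘ₗ LieAlgebra.ad ℝ 𝔡 a =
        Λ ∘ₗ diffAction hρ hf x - actionDual ρ x (diff E (applyField (ρ a) f) x) := by
    intro f hf
    ext b
    exact (diffAction_sub hρ hf x b a).symm
  have h2 := apply_diff_bracket_pushTwo hρ s hf hg x Λ
  rw [had hf, had hg, map_sub, map_sub, LinearMap.sub_apply]
  change Λ (diff E (bracket (pushTwo ρ s) f g) x) -
    s (actionDual ρ x (diff E (applyField (ρ a) f) x)) (actionDual ρ x (diff E g x)) -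
    s (actionDual ρ x (diff E f x)) (actionDual ρ x (diff E (applyField (ρ a) g) x)) = _
  rw [h2]
  ring

theorem IsQuasiPoisson.lieDerivative_sub_pushTwo [CompleteSpace E] (hM : IsQuasiPoisson B ρ π)
    (s : Module.Dual ℝ 𝔡 →ₗ[ℝ] Module.Dual ℝ 𝔡 →ₗ[ℝ] ℝ) (a : 𝔡) {f g : M → ℝ}
    (hf : IsSmoothFun E f) (hg : IsSmoothFun E g) (x : M) :
    lieDerivative (ρ a) (π - pushTwo ρ s) f g x =
      -(s (actionDual ρ x (diff E f x) ∘ₗ LieAlgebra.ad ℝ 𝔡 a) (actionDual ρ x (diff E g x)) +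
      s (actionDual ρ x (diff E f x)) (actionDual ρ x (diff E g x) ∘ₗ LieAlgebra.ad ℝ 𝔡 a)) := by
  rw [← lieDerivative_pushTwo hM.action s a hf hg]
  have h1 := hM.invariant a f g hf hg x
  have h2 : diff E (bracket (π - pushTwo ρ s) f g) x =
      diff E (bracket π f g) x - diff E (bracket (pushTwo ρ s) f g) x := by
    rw [bracket_sub, diff_sub (hM.bivector.smooth f g hf hg)
      (isSmoothFun_bracket_pushTwo hM.action s hf hg)]
  rw [lieDerivative] at h1 ⊢
  rw [h2, lieDerivative, bracket_sub, bracket_sub]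
  simp only [Pi.sub_apply, _root_.sub_apply]
  linear_combination h1

end Twist

/-! ### Immersions: local left inverses, extension of functions, related vector fields. -/

section Immersion

open scoped Topology

variable {E₁ : Type*} [NormedAddCommGroup E₁] [NormedSpace ℝ E₁]
  {X : Type*} [TopologicalSpace X] [ChartedSpace E₁ X]
  {E : Type*} [NormedAddCommGroup E] [NormedSpace ℝ E]
  {M : Type*} [TopologicalSpace M] [ChartedSpace E M]
  {ι : X → M}

theorem mdifferentiableAt_immersion (hι : IsImmersion 𝓘(ℝ, E₁) 𝓘(ℝ, E) ∞ ι) (x : X) :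
    MDifferentiableAt 𝓘(ℝ, E₁) 𝓘(ℝ, E) ι x :=
  hι.contMDiff.mdifferentiable (by simp) x

theorem mfderiv_leftInverse_apply (hι : IsImmersion 𝓘(ℝ, E₁) 𝓘(ℝ, E) ∞ ι) {r : M → X} {x : X}
    (hr : MDifferentiableAt 𝓘(ℝ, E) 𝓘(ℝ, E₁) r (ι x)) (hrι : ∀ᶠ y in 𝓝 x, r (ι y) = y) (v : E₁) :
    (mfderiv 𝓘(ℝ, E) 𝓘(ℝ, E₁) r (ι x) (mfderiv 𝓘(ℝ, E₁) 𝓘(ℝ, E) ι x v) : E₁) = v := by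
  have h1 := hr.hasMFDerivAt.comp x (mdifferentiableAt_immersion hι x).hasMFDerivAt
  have h2 := (hasMFDerivAt_id (I := 𝓘(ℝ, E₁)) x).congr_of_eventuallyEq (f₁ := r ∘ ι) hrι
  exact congrArg (fun L : E₁ →L[ℝ] E₁ => L v) (hasMFDerivAt_unique h1 h2)

/-- An immersion has smooth local left inverses. -/
theorem exists_local_leftInverse (hι : IsImmersion 𝓘(ℝ, E₁) 𝓘(ℝ, E) ∞ ι) (x : X) :
    ∃ (r : M → X) (U : Set M), IsOpen U ∧ ι x ∈ U ∧ ContMDiffOn 𝓘(ℝ, E) 𝓘(ℝ, E₁) ∞ r U ∧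
      ∀ᶠ y in 𝓝 x, r (ι y) = y := by
  have h := hι.isImmersionAt x
  -- In adapted charts `ι` is `u ↦ (u, 0)`, so the first component recovers the coordinates on `X`.
  let p : M → E₁ := fun m => (h.equiv.symm (h.codChart.extend 𝓘(ℝ, E) m)).1
  have hp : ContMDiffOn 𝓘(ℝ, E) 𝓘(ℝ, E₁) ∞ p h.codChart.source :=
    ((ContinuousLinearMap.fst ℝ E₁ h.complement).comp
      (h.equiv.symm : E →L[ℝ] E₁ × h.complement)).contMDiff.comp_contMDiffOn
      (h.codChart.contMDiffOn_extend h.codChart_mem_maximalAtlas)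
  have hpι : ∀ y ∈ h.domChart.source, p (ι y) = h.domChart.extend 𝓘(ℝ, E₁) y := by
    intro y hy
    have h1 := h.writtenInCharts ((h.domChart.extend 𝓘(ℝ, E₁)).map_source
      (by rwa [h.domChart.extend_source]))
    simp only [Function.comp_apply] at h1
    rw [h.domChart.extend_left_inv hy] at h1
    simp only [p, h1, ContinuousLinearEquiv.symm_apply_apply]
  refine ⟨fun m => (h.domChart.extend 𝓘(ℝ, E₁)).symm (p m),
    h.codChart.source ∩ p ⁻¹' h.domChart.target,
    hp.continuousOn.isOpen_inter_preimage h.codChart.open_source h.domChart.open_target,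
    ⟨h.mem_codChart_source, ?_⟩, ?_, ?_⟩
  · rw [mem_preimage, hpι x h.mem_domChart_source]
    exact h.domChart.map_source h.mem_domChart_source
  · refine (contMDiffOn_extend_symm h.domChart_mem_maximalAtlas).comp
      (hp.mono inter_subset_left) fun m hm => ⟨p m, hm.2, rfl⟩
  · filter_upwards [h.domChart.open_source.mem_nhds h.mem_domChart_source] with y hy
    rw [hpι y hy, h.domChart.extend_left_inv hy]

theorem mfderiv_injective (hι : IsImmersion 𝓘(ℝ, E₁) 𝓘(ℝ, E) ∞ ι) (x : X) :
    Function.Injective (mfderiv 𝓘(ℝ, E₁) 𝓘(ℝ, E) ι x) := by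
  obtain ⟨r, U, hU, hx, hr, hrι⟩ := exists_local_leftInverse hι x
  have hrd := (hr.contMDiffAt (hU.mem_nhds hx)).mdifferentiableAt (by simp)
  intro v w hvw
  exact (mfderiv_leftInverse_apply hι hrd hrι v).symm.trans
    ((congrArg (mfderiv 𝓘(ℝ, E) 𝓘(ℝ, E₁) r (ι x)) hvw).trans
      (mfderiv_leftInverse_apply hι hrd hrι w))

variable [IsManifold 𝓘(ℝ, E) ∞ M]

/-- Functions on an immersed manifold are locally restrictions of functions on the ambient one. -/
theorem exists_local_extension [FiniteDimensional ℝ E] [T2Space M]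
    (hι : IsImmersion 𝓘(ℝ, E₁) 𝓘(ℝ, E) ∞ ι) {f : X → ℝ} (hf : IsSmoothFun E₁ f) (x : X) :
    ∃ F : M → ℝ, IsSmoothFun E F ∧ f =ᶠ[𝓝 x] F ∘ ι := by
  obtain ⟨r, U, hU, hx, hr, hrι⟩ := exists_local_leftInverse hι x
  obtain ⟨F, hF, hFe⟩ := exists_isSmoothFun_eventuallyEq (E := E) (f := f ∘ r) (hU.mem_nhds hx)
    (ContMDiff.comp_contMDiffOn hf hr)
  refine ⟨F, hF, ?_⟩
  filter_upwards [hrι, (mdifferentiableAt_immersion hι x).continuousAt.eventually hFe] with y h1 h2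
  rw [Function.comp_apply, h2, Function.comp_apply, h1]

variable [IsManifold 𝓘(ℝ, E₁) ∞ X]

/-- A vector field `V` which is `ι`-related to a smooth one is smooth. -/
theorem contMDiff_of_related (hι : IsImmersion 𝓘(ℝ, E₁) 𝓘(ℝ, E) ∞ ι)
    {V : Π x : X, TangentSpace 𝓘(ℝ, E₁) x} {W : Π x : M, TangentSpace 𝓘(ℝ, E) x}
    (hW : ContMDiff 𝓘(ℝ, E) 𝓘(ℝ, E).tangent ∞ (fun x => (⟨x, W x⟩ : TangentBundle 𝓘(ℝ, E) M)))
    (hVW : ∀ x, mfderiv 𝓘(ℝ, E₁) 𝓘(ℝ, E) ι x (V x) = W (ι x)) :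
    ContMDiff 𝓘(ℝ, E₁) 𝓘(ℝ, E₁).tangent ∞
      (fun x => (⟨x, V x⟩ : TangentBundle 𝓘(ℝ, E₁) X)) := by
  intro x
  obtain ⟨r, U, hU, hx, hr, hrι⟩ := exists_local_leftInverse hι x
  -- Near `x` the field `V` equals `Tr ∘ W ∘ ι`, which is smooth.
  have hT := hr.contMDiffOn_tangentMapWithin (m := ∞) (by simp) hU.uniqueMDiffOn
  have hUT : IsOpen (Bundle.TotalSpace.proj (F := E) (E := TangentSpace 𝓘(ℝ, E) (M := M)) ⁻¹' U) :=
    hU.preimage (FiberBundle.continuous_proj E _)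
  have hT' := hT.contMDiffAt (x := ⟨ι x, W (ι x)⟩) (hUT.mem_nhds hx)
  have hc := hT'.comp x ((hW.comp hι.contMDiff) x)
  refine hc.congr_of_eventuallyEq ?_
  filter_upwards [eventually_eventually_nhds.2 hrι,
    (mdifferentiableAt_immersion hι x).continuousAt.eventually (hU.mem_nhds hx)] with y h1 h2
  have hrd := (hr.contMDiffAt (hU.mem_nhds h2)).mdifferentiableAt (by simp)
  have h3 := mfderiv_leftInverse_apply hι hrd h1 (V y)
  rw [hVW] at h3
  refine Bundle.TotalSpace.ext h1.self_of_nhds.symm (heq_of_eq ?_)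
  change (V y : E₁) = mfderivWithin 𝓘(ℝ, E) 𝓘(ℝ, E₁) r U (ι y) (W (ι y))
  rw [mfderivWithin_of_isOpen hU h2]
  exact h3.symm

/-- Differentials of smooth functions on `M` separate tangent vectors, and on functions `F ∘ ι` both
brackets act as commutators of related derivations. -/
theorem mlieBracket_related [FiniteDimensional ℝ E] [T2Space M] [CompleteSpace E₁]
    (hι : IsImmersion 𝓘(ℝ, E₁) 𝓘(ℝ, E) ∞ ι)
    {V V' : Π x : X, TangentSpace 𝓘(ℝ, E₁) x} {W W' : Π x : M, TangentSpace 𝓘(ℝ, E) x}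
    (hW : ContMDiff 𝓘(ℝ, E) 𝓘(ℝ, E).tangent ∞ (fun x => (⟨x, W x⟩ : TangentBundle 𝓘(ℝ, E) M)))
    (hW' : ContMDiff 𝓘(ℝ, E) 𝓘(ℝ, E).tangent ∞ (fun x => (⟨x, W' x⟩ : TangentBundle 𝓘(ℝ, E) M)))
    (hVW : ∀ x, mfderiv 𝓘(ℝ, E₁) 𝓘(ℝ, E) ι x (V x) = W (ι x))
    (hVW' : ∀ x, mfderiv 𝓘(ℝ, E₁) 𝓘(ℝ, E) ι x (V' x) = W' (ι x)) (x : X) :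
    mfderiv 𝓘(ℝ, E₁) 𝓘(ℝ, E) ι x (mlieBracket 𝓘(ℝ, E₁) V V' x) =
      mlieBracket 𝓘(ℝ, E) W W' (ι x) := by
  have key : ∀ {F : M → ℝ}, IsSmoothFun E F → ∀ y (v : TangentSpace 𝓘(ℝ, E₁) y),
      diff E₁ (F ∘ ι) y v = diff E F (ι y) (mfderiv 𝓘(ℝ, E₁) 𝓘(ℝ, E) ι y v) := by
    intro F hF y v
    rw [diff_comp_apply (hF.mdifferentiableAt _) (mdifferentiableAt_immersion hι y)]
    rfl
  have hap : ∀ {F : M → ℝ}, IsSmoothFun E F → ∀ {V : Π x : X, TangentSpace 𝓘(ℝ, E₁) x}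
      {W : Π x : M, TangentSpace 𝓘(ℝ, E) x},
      (∀ x, mfderiv 𝓘(ℝ, E₁) 𝓘(ℝ, E) ι x (V x) = W (ι x)) →
      applyField V (F ∘ ι) = applyField W F ∘ ι := by
    intro F hF V W hVW
    funext y
    rw [applyField, key hF, hVW]
    rfl
  have sep : ∀ u v : E, (∀ F : M → ℝ, IsSmoothFun E F →
      diff E F (ι x) u = diff E F (ι x) v) → u = v := by
    intro u v h
    refine (SeparatingDual.eq_iff_forall_dual_eq (R := ℝ)).2 fun α => ?_
    obtain ⟨F, hF, hFα⟩ := exists_diff_eq (ι x) (α : Cotangent E (ι x))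
    have := h F hF
    rwa [hFα] at this
  have hV := contMDiff_of_related hι hW hVW
  have hV' := contMDiff_of_related hι hW' hVW'
  refine sep _ _ fun F hF => ?_
  have hFι : IsSmoothFun E₁ (F ∘ ι) := ContMDiff.comp hF hι.contMDiff
  have hC : CompleteSpace E := FiniteDimensional.complete ℝ E
  refine (key hF x _).symm.trans ?_
  rw [diff_mlieBracket hV hV' hFι, diff_mlieBracket hW hW' hF, hap hF hVW, hap hF hVW',
    key (hF.applyField hW'), key (hF.applyField hW), hVW, hVW']

end Immersion

/-! ### Restriction of bivector fields and actions to an immersed manifold. -/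

section Restriction

open scoped Topology

variable {E₁ : Type*} [NormedAddCommGroup E₁] [NormedSpace ℝ E₁]
  {X : Type*} [TopologicalSpace X] [ChartedSpace E₁ X]
  {E : Type*} [NormedAddCommGroup E] [NormedSpace ℝ E]
  {M : Type*} [TopologicalSpace M] [ChartedSpace E M]
  {ι : X → M}

/-- The choice is pointwise, with no regularity in `x`. It is enough to define restrictions, whose
smoothness is then proved by other means. -/
theorem exists_leftInverse_mfderiv (hι : IsImmersion 𝓘(ℝ, E₁) 𝓘(ℝ, E) ∞ ι) :
    ∃ L : ∀ x, TangentSpace 𝓘(ℝ, E) (ι x) →L[ℝ] TangentSpace 𝓘(ℝ, E₁) x,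
      ∀ x v, L x (mfderiv 𝓘(ℝ, E₁) 𝓘(ℝ, E) ι x v) = v := by
  choose r U hU hx hr hrι using exists_local_leftInverse hι
  exact ⟨fun x => (mfderiv 𝓘(ℝ, E) 𝓘(ℝ, E₁) (r x) (ι x) : E →L[ℝ] E₁), fun x v =>
    mfderiv_leftInverse_apply hι
      (((hr x).contMDiffAt ((hU x).mem_nhds (hx x))).mdifferentiableAt (by simp)) (hrι x) v⟩

/-- The bivector field `π₁` on `X` is the restriction along `ι` of `π`. -/
def IsRestriction (ι : X → M) (π₁ : TwoTensor E₁ X) (π : TwoTensor E M) : Prop :=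
  ∀ (x : X) (α β : Cotangent E (ι x)),
    π₁ x (α ∘L mfderiv 𝓘(ℝ, E₁) 𝓘(ℝ, E) ι x) (β ∘L mfderiv 𝓘(ℝ, E₁) 𝓘(ℝ, E) ι x) = π (ι x) α β

/-- A bivector field which is tangent to `X` can be restricted to `X`. -/
theorem exists_isRestriction (hι : IsImmersion 𝓘(ℝ, E₁) 𝓘(ℝ, E) ∞ ι) {π : TwoTensor E M}
    (hπ : IsBivectorField π)
    (htan : ∀ (x : X) (α β : Cotangent E (ι x)),
      α ∘L mfderiv 𝓘(ℝ, E₁) 𝓘(ℝ, E) ι x = 0 → π (ι x) α β = 0) :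
    ∃ π₁ : TwoTensor E₁ X, (∀ x α, π₁ x α α = 0) ∧ IsRestriction ι π₁ π := by
  obtain ⟨L, hL⟩ := exists_leftInverse_mfderiv hι
  let T : ∀ x, Cotangent E₁ x →ₗ[ℝ] Cotangent E (ι x) := fun x =>
    { toFun := fun α => α ∘L L x
      map_add' := fun _ _ => rfl
      map_smul' := fun _ _ => rfl }
  refine ⟨fun x => (π (ι x)).compl₁₂ (T x) (T x), fun x α => hπ.alternating _ _, ?_⟩
  intro x α β
  -- Restricting `α` to `TX` and extending back by `T` changes it only by a covector killing `TX`,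
  -- which `π` does not see in the first slot, nor by skewness in the second.
  have hT : ∀ α : Cotangent E (ι x), (α - T x (α ∘L mfderiv 𝓘(ℝ, E₁) 𝓘(ℝ, E) ι x)) ∘L
      mfderiv 𝓘(ℝ, E₁) 𝓘(ℝ, E) ι x = 0 := by
    intro α
    ext v
    exact sub_eq_zero.2 (congrArg (fun w => α (mfderiv 𝓘(ℝ, E₁) 𝓘(ℝ, E) ι x w)) (hL x v)).symm
  have h1 : ∀ α β : Cotangent E (ι x),
      π (ι x) (T x (α ∘L mfderiv 𝓘(ℝ, E₁) 𝓘(ℝ, E) ι x)) β = π (ι x) α β := by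
    intro α β
    have := htan x _ β (hT α)
    rw [map_sub, LinearMap.sub_apply] at this
    linear_combination -this
  rw [LinearMap.compl₁₂_apply, h1, hπ.swap, h1, hπ.swap, neg_neg]

variable {π₁ : TwoTensor E₁ X} {π : TwoTensor E M}

theorem diff_restriction_eq (hι : IsImmersion 𝓘(ℝ, E₁) 𝓘(ℝ, E) ∞ ι) {f : X → ℝ} {F : M → ℝ}
    (hF : IsSmoothFun E F) {x : X} (hfF : f =ᶠ[𝓝 x] F ∘ ι) :
    diff E₁ f x = diff E F (ι x) ∘L mfderiv 𝓘(ℝ, E₁) 𝓘(ℝ, E) ι x := by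
  rw [diff_congr hfF, diff_comp_apply (hF.mdifferentiableAt _) (mdifferentiableAt_immersion hι x)]

/-- Equality is needed near `x`, not only at `x`, so that the bracket can be iterated and
differentiated. -/
theorem IsRestriction.bracket_eventuallyEq (hπ₁ : IsRestriction ι π₁ π)
    (hι : IsImmersion 𝓘(ℝ, E₁) 𝓘(ℝ, E) ∞ ι) {f g : X → ℝ} {F G : M → ℝ}
    (hF : IsSmoothFun E F) (hG : IsSmoothFun E G) {x : X} (hfF : f =ᶠ[𝓝 x] F ∘ ι)
    (hgG : g =ᶠ[𝓝 x] G ∘ ι) : bracket π₁ f g =ᶠ[𝓝 x] bracket π F G ∘ ι := by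
  filter_upwards [hfF.eventuallyEq_nhds, hgG.eventuallyEq_nhds] with y hf hg
  rw [bracket, diff_restriction_eq hι hF hf, diff_restriction_eq hι hG hg, hπ₁]
  rfl

theorem IsRestriction.halfSchouten_eq (hπ₁ : IsRestriction ι π₁ π) (hπ : IsBivectorField π)
    (hι : IsImmersion 𝓘(ℝ, E₁) 𝓘(ℝ, E) ∞ ι) {f g h : X → ℝ} {F G H : M → ℝ}
    (hF : IsSmoothFun E F) (hG : IsSmoothFun E G) (hH : IsSmoothFun E H) {x : X}
    (hfF : f =ᶠ[𝓝 x] F ∘ ι) (hgG : g =ᶠ[𝓝 x] G ∘ ι) (hhH : h =ᶠ[𝓝 x] H ∘ ι) :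
    halfSchouten π₁ f g h x = halfSchouten π F G H (ι x) := by
  have key : ∀ {f g h : X → ℝ} {F G H : M → ℝ}, IsSmoothFun E F → IsSmoothFun E G →
      IsSmoothFun E H → f =ᶠ[𝓝 x] F ∘ ι → g =ᶠ[𝓝 x] G ∘ ι → h =ᶠ[𝓝 x] H ∘ ι →
      bracket π₁ f (bracket π₁ g h) x = bracket π F (bracket π G H) (ι x) :=
    fun hF hG hH hf hg hh => (hπ₁.bracket_eventuallyEq hι hF (hπ.smooth _ _ hG hH) hf
      (hπ₁.bracket_eventuallyEq hι hG hH hg hh)).self_of_nhds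
  rw [halfSchouten, halfSchouten, key hF hG hH hfF hgG hhH, key hG hH hF hgG hhH hfF,
    key hH hF hG hhH hfF hgG]

variable [IsManifold 𝓘(ℝ, E) ∞ M]

theorem IsRestriction.lieDerivative_eq (hπ₁ : IsRestriction ι π₁ π) (hπ : IsBivectorField π)
    (hι : IsImmersion 𝓘(ℝ, E₁) 𝓘(ℝ, E) ∞ ι) {V : Π x : X, TangentSpace 𝓘(ℝ, E₁) x}
    {W : Π x : M, TangentSpace 𝓘(ℝ, E) x}
    (hW : ContMDiff 𝓘(ℝ, E) 𝓘(ℝ, E).tangent ∞ (fun x => (⟨x, W x⟩ : TangentBundle 𝓘(ℝ, E) M)))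
    (hVW : ∀ x, mfderiv 𝓘(ℝ, E₁) 𝓘(ℝ, E) ι x (V x) = W (ι x)) {f g : X → ℝ} {F G : M → ℝ}
    (hF : IsSmoothFun E F) (hG : IsSmoothFun E G) {x : X}
    (hfF : f =ᶠ[𝓝 x] F ∘ ι) (hgG : g =ᶠ[𝓝 x] G ∘ ι) :
    lieDerivative V π₁ f g x = lieDerivative W π F G (ι x) := by
  have hap : ∀ {f : X → ℝ} {F : M → ℝ}, IsSmoothFun E F → ∀ {y : X}, f =ᶠ[𝓝 y] F ∘ ι →
      diff E₁ f y (V y) = diff E F (ι y) (W (ι y)) := by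
    intro f F hF y hf
    rw [diff_restriction_eq hι hF hf, ← hVW]
    rfl
  have hap' : ∀ {f : X → ℝ} {F : M → ℝ}, IsSmoothFun E F → f =ᶠ[𝓝 x] F ∘ ι →
      applyField V f =ᶠ[𝓝 x] applyField W F ∘ ι := by
    intro f F hF hf
    filter_upwards [hf.eventuallyEq_nhds] with y hy using hap hF hy
  have h1 := hap (hπ.smooth F G hF hG) (hπ₁.bracket_eventuallyEq hι hF hG hfF hgG)
  have h2 := (hπ₁.bracket_eventuallyEq hι (hF.applyField hW) hG (hap' hF hfF) hgG).self_of_nhds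
  have h3 := (hπ₁.bracket_eventuallyEq hι hF (hG.applyField hW) hfF (hap' hG hgG)).self_of_nhds
  exact congrArg₂ (· - ·) (congrArg₂ (· - ·) h1 h2) h3

variable [FiniteDimensional ℝ E] [T2Space M]

theorem IsRestriction.isBivectorField (hπ₁ : IsRestriction ι π₁ π) (hπ : IsBivectorField π)
    (hι : IsImmersion 𝓘(ℝ, E₁) 𝓘(ℝ, E) ∞ ι) (halt : ∀ x α, π₁ x α α = 0) :
    IsBivectorField π₁ where
  alternating := halt
  smooth f g hf hg x := by
    obtain ⟨F, hF, hfF⟩ := exists_local_extension hι hf x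
    obtain ⟨G, hG, hgG⟩ := exists_local_extension hι hg x
    exact ((ContMDiff.comp (hπ.smooth F G hF hG) hι.contMDiff) x).congr_of_eventuallyEq
      (hπ₁.bracket_eventuallyEq hι hF hG hfF hgG)

variable [IsManifold 𝓘(ℝ, E₁) ∞ X]

/-- A Lie algebra acting by vector fields tangent to `X` acts on `X`. -/
theorem exists_action_restriction {𝔤 : Type*} [LieRing 𝔤] [LieAlgebra ℝ 𝔤] [CompleteSpace E₁]
    (hι : IsImmersion 𝓘(ℝ, E₁) 𝓘(ℝ, E) ∞ ι)
    {ρ : 𝔤 →ₗ[ℝ] Π x : M, TangentSpace 𝓘(ℝ, E) x} (hρ : IsAction ρ)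
    (𝔥 : LieSubalgebra ℝ 𝔤) (h𝔥 : ∀ (a : 𝔥) (x : X),
      ∃ v, mfderiv 𝓘(ℝ, E₁) 𝓘(ℝ, E) ι x v = ρ a (ι x)) :
    ∃ ρ₁ : 𝔥 →ₗ[ℝ] Π x : X, TangentSpace 𝓘(ℝ, E₁) x, IsAction ρ₁ ∧
      ∀ (a : 𝔥) (x : X), mfderiv 𝓘(ℝ, E₁) 𝓘(ℝ, E) ι x (ρ₁ a x) = ρ a (ι x) := by
  obtain ⟨L, hL⟩ := exists_leftInverse_mfderiv hι
  let ρ₁ : 𝔥 →ₗ[ℝ] Π x : X, TangentSpace 𝓘(ℝ, E₁) x :=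
    { toFun := fun a x => L x (ρ a (ι x))
      map_add' := fun a b => by
        funext x
        simp
      map_smul' := fun c a => by
        funext x
        simp }
  have hρ₁ : ∀ (a : 𝔥) (x : X), mfderiv 𝓘(ℝ, E₁) 𝓘(ℝ, E) ι x (ρ₁ a x) = ρ a (ι x) := by
    intro a x
    obtain ⟨v, hv⟩ := h𝔥 a x
    change mfderiv 𝓘(ℝ, E₁) 𝓘(ℝ, E) ι x (L x (ρ a (ι x))) = ρ a (ι x)
    rw [← hv, hL]
  refine ⟨ρ₁, ⟨fun a => contMDiff_of_related hι (hρ.smooth a) (hρ₁ a), fun a b => ?_⟩, hρ₁⟩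
  funext x
  refine mfderiv_injective hι x ?_
  rw [hρ₁, mlieBracket_related hι (hρ.smooth a) (hρ.smooth b) (hρ₁ a) (hρ₁ b), LieSubalgebra.coe_bracket,
    hρ.lie]

end Restriction

/-! ### The twisted bivector field along a left leaf. -/

section Leaf

variable {𝔡 : Type*} [LieRing 𝔡] [LieAlgebra ℝ 𝔡] [FiniteDimensional ℝ 𝔡] {B : InvariantPairing 𝔡}
  {E : Type*} [NormedAddCommGroup E] [NormedSpace ℝ E]
  {M : Type u} [TopologicalSpace M] [ChartedSpace E M]
  {ρ : 𝔡 →ₗ[ℝ] Π x : M, TangentSpace 𝓘(ℝ, E) x} {π : TwoTensor E M}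

theorem sub_pushTwo_twist_apply {𝔥 : LieSubalgebra ℝ 𝔡} {𝔥s : Submodule ℝ 𝔡}
    (hc : IsCompl 𝔥.toSubmodule 𝔥s) (h𝔥 : IsLagrangian B 𝔥.toSubmodule)
    (h𝔥s : IsLagrangian B 𝔥s) (x : M) (α β : Cotangent E x) :
    (π - pushTwo ρ (twist B hc)) x α β =
      sigma B ρ π x α β - β (ρ (complPart B hc (actionDual ρ x α)) x) := by
  have h1 : (π - pushTwo ρ (twist B hc)) x α β =
      π x α β - twist B hc (actionDual ρ x α) (actionDual ρ x β) := rfl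
  have h2 : sigma B ρ π x α β =
      π x α β + (1 / 2) * tElement B (actionDual ρ x α) (actionDual ρ x β) := rfl
  have h3 : actionDual ρ x β (complPart B hc (actionDual ρ x α)) =
      β (ρ (complPart B hc (actionDual ρ x α)) x) := rfl
  rw [h1, h2, twist_eq_sub_tElement B hc h𝔥 h𝔥s, h3]
  ring

/-- By reflexivity of the finite-dimensional space `E`, the functional `σ(·, β)` is evaluation at a
vector; that vector lies in `T^L M`, so `α` kills it. -/
theorem sigma_eq_zero_of_forall_leftDistribution [FiniteDimensional ℝ E] (x : M)
    (α β : Cotangent E x) (h : ∀ v ∈ leftDistribution B ρ π x, α v = 0) :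
    sigma B ρ π x α β = 0 := by
  let e : (E →ₗ[ℝ] ℝ) ≃ₗ[ℝ] (E →L[ℝ] ℝ) := LinearMap.toContinuousLinearMap
  let φ : Module.Dual ℝ (Module.Dual ℝ E) :=
    (LinearMap.flip (sigma B ρ π x) β : (E →L[ℝ] ℝ) →ₗ[ℝ] ℝ) ∘ₗ e.toLinearMap
  let v : E := (Module.evalEquiv ℝ E).symm φ
  have hv : ∀ γ : Cotangent E x, γ v = sigma B ρ π x γ β := by
    intro γ
    have h1 := Module.apply_evalEquiv_symm_apply (R := ℝ) (M := E) (e.symm γ) φ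
    have h2 : φ (e.symm γ) = sigma B ρ π x γ β := by
      exact congrArg (fun γ => sigma B ρ π x γ β) (e.apply_symm_apply γ)
    exact h1.trans h2
  rw [← hv]
  exact h v ⟨β, hv⟩

end Leaf

end QuasiPoisson

end

/-! ### Assembly of the theorem. -/

theorem mainTheorem8
    {𝔡 : Type*} [LieRing 𝔡] [LieAlgebra ℝ 𝔡] [FiniteDimensional ℝ 𝔡]
    (B : QuasiPoisson.InvariantPairing 𝔡)
    {E : Type*} [NormedAddCommGroup E] [NormedSpace ℝ E] [FiniteDimensional ℝ E]
    {M : Type u} [TopologicalSpace M] [T2Space M] [SecondCountableTopology M]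
    [ChartedSpace E M] [IsManifold 𝓘(ℝ, E) ∞ M]
    (ρ : 𝔡 →ₗ[ℝ] Π x : M, TangentSpace 𝓘(ℝ, E) x) (π : QuasiPoisson.TwoTensor E M)
    (hM : QuasiPoisson.IsSplitSymplectic B ρ π)
    -- the left leaf `X`, with its inclusion `ι`
    {k : ℕ} {X : Type u} [TopologicalSpace X] [ChartedSpace (EuclideanSpace ℝ (Fin k)) X]
    [IsManifold (𝓡 k) ∞ X] (ι : X → M)
    (hX : QuasiPoisson.IsLeaf (QuasiPoisson.leftDistribution B ρ π) (k := k) ι)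
    -- its stabilizer `𝔥`, with a Lagrangian complement `𝔥s`
    (𝔥 : LieSubalgebra ℝ 𝔡) (h𝔥 : 𝔥.toSubmodule = QuasiPoisson.stabilizer ρ (k := k) ι)
    (𝔥s : Submodule ℝ 𝔡) (h𝔥s : QuasiPoisson.IsLagrangian B 𝔥s)
    (hc : IsCompl 𝔥.toSubmodule 𝔥s)
    -- the right-central map `μ`
    {E' : Type*} [NormedAddCommGroup E'] [NormedSpace ℝ E'] [FiniteDimensional ℝ E']
    {N : Type*} [TopologicalSpace N] [T2Space N] [SecondCountableTopology N]
    [ChartedSpace E' N] [IsManifold 𝓘(ℝ, E') ∞ N]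
    (ρN : 𝔡 →ₗ[ℝ] Π y : N, TangentSpace 𝓘(ℝ, E') y)
    (μ : M → N) (hμ : QuasiPoisson.IsRightCentralMap B ρ π ρN μ) :
    ∃ (ρX : 𝔥 →ₗ[ℝ] Π x : X, TangentSpace (𝓡 k) x)
      (πX : QuasiPoisson.TwoTensor (EuclideanSpace ℝ (Fin k)) X),
      -- `ρX` is the restriction to `X` of the action of `𝔥`
      (∀ (a : 𝔥) (x : X), mfderiv (𝓡 k) 𝓘(ℝ, E) ι x (ρX a x) = ρ a (ι x)) ∧
      -- `πX` is the restriction to `X` of the bivector field `π - ρ^{⊗2}(½ ∑ᵢ eᵢ ∧ eⁱ)`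
      (∀ (x : X) (α β : QuasiPoisson.Cotangent E (ι x)),
        πX x (α ∘L mfderiv (𝓡 k) 𝓘(ℝ, E) ι x) (β ∘L mfderiv (𝓡 k) 𝓘(ℝ, E) ι x) =
          (π - QuasiPoisson.pushTwo ρ (QuasiPoisson.twist B hc)) (ι x) α β) ∧
      -- the restriction of `μ` is a moment map
      QuasiPoisson.IsMomentMap B hc ρX πX ρN (μ ∘ ι) := by
  obtain ⟨hQ, -, hL⟩ := hM
  have h𝔥L : QuasiPoisson.IsLagrangian B 𝔥.toSubmodule := by
    rw [h𝔥]
    exact hL k X ι hX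
  have hι := hX.integral.immersion
  have htan : ∀ (a : 𝔥) (x : X), ∃ v, mfderiv (𝓡 k) 𝓘(ℝ, E) ι x v = ρ a (ι x) := by
    intro a x
    have ha : (a : 𝔡) ∈ QuasiPoisson.stabilizer ρ (k := k) ι := h𝔥 ▸ a.2
    rw [QuasiPoisson.stabilizer, Submodule.mem_iInf] at ha
    exact ha x
  have hC : CompleteSpace E := FiniteDimensional.complete ℝ E
  obtain ⟨ρX, hρX, hρXι⟩ := QuasiPoisson.exists_action_restriction hι hQ.action 𝔥 htan
  have hsub : ∀ (x : X) (α : QuasiPoisson.Cotangent E (ι x)),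
      QuasiPoisson.actionDual ρ (ι x) α ∘ₗ 𝔥.toSubmodule.subtype =
        QuasiPoisson.actionDual ρX x (α ∘L mfderiv (𝓡 k) 𝓘(ℝ, E) ι x) := by
    intro x α
    ext a
    exact congrArg α (hρXι a x).symm
  have hcompl : ∀ (x : X) (α : QuasiPoisson.Cotangent E (ι x)),
      QuasiPoisson.complPart B hc (QuasiPoisson.actionDual ρ (ι x) α) =
        QuasiPoisson.toComplement B hc (QuasiPoisson.actionDual ρX x
          (α ∘L mfderiv (𝓡 k) 𝓘(ℝ, E) ι x)) := by
    intro x α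
    rw [QuasiPoisson.complPart, hsub]
  have hswap := QuasiPoisson.twist_swap B hc
  have hπ' := hQ.bivector.sub_pushTwo hQ.action hswap
  -- Tangency of `π'`: for `α` killing `TX`, the `σ`-term vanishes because `TX = T^L M` along `X`,
  -- and the other because `p(ρ^*α)` depends only on `α` restricted to `TX`.
  obtain ⟨πX, halt, hπX⟩ := QuasiPoisson.exists_isRestriction hι hπ' (by
    intro x α β hα
    rw [QuasiPoisson.sub_pushTwo_twist_apply hc h𝔥L h𝔥s, hcompl, hα, map_zero, map_zero, map_zero,
      QuasiPoisson.sigma_eq_zero_of_forall_leftDistribution, sub_eq_zero]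
    · exact (map_zero β).symm
    · intro v hv
      rw [← hX.integral.tangent x] at hv
      obtain ⟨w, rfl⟩ := hv
      exact congrArg (fun L => L w) hα)
  have hManin : QuasiPoisson.IsManinQuasiPoisson B hc ρX πX := by
    refine ⟨h𝔥L, h𝔥s, hρX, hπX.isBivectorField hπ' hι halt, ?_, ?_⟩
    · intro f g h hf hg hh x
      obtain ⟨F, hF, hfF⟩ := QuasiPoisson.exists_local_extension hι hf x
      obtain ⟨G, hG, hgG⟩ := QuasiPoisson.exists_local_extension hι hg x
      obtain ⟨H, hH, hhH⟩ := QuasiPoisson.exists_local_extension hι hh x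
      rw [hπX.halfSchouten_eq hπ' hι hF hG hH hfF hgG hhH,
        hQ.halfSchouten_sub_pushTwo hswap (QuasiPoisson.twist_eq_apply B hc h𝔥L h𝔥s) hF hG hH,
        QuasiPoisson.phi_add_twist B hc h𝔥L _ _ _ _ fun _ => rfl, hcompl, hcompl, hcompl,
        ← QuasiPoisson.diff_restriction_eq hι hF hfF, ← QuasiPoisson.diff_restriction_eq hι hG hgG,
        ← QuasiPoisson.diff_restriction_eq hι hH hhH]
      rfl
    · intro a f g hf hg x
      obtain ⟨F, hF, hfF⟩ := QuasiPoisson.exists_local_extension hι hf x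
      obtain ⟨G, hG, hgG⟩ := QuasiPoisson.exists_local_extension hι hg x
      rw [hπX.lieDerivative_eq hπ' hι (hQ.action.smooth a) (hρXι a) hF hG hfF hgG,
        hQ.lieDerivative_sub_pushTwo _ _ hF hG, QuasiPoisson.twist_lie B hc h𝔥L h𝔥s, hcompl, hcompl,
        ← QuasiPoisson.diff_restriction_eq hι hF hfF, ← QuasiPoisson.diff_restriction_eq hι hG hgG]
      rfl
  have hμd : ∀ x, mfderiv (𝓡 k) 𝓘(ℝ, E') (μ ∘ ι) x =
      mfderiv 𝓘(ℝ, E) 𝓘(ℝ, E') μ (ι x) ∘L mfderiv (𝓡 k) 𝓘(ℝ, E) ι x := fun x =>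
    mfderiv_comp x (hμ.smooth.mdifferentiable (by simp) _)
      (QuasiPoisson.mdifferentiableAt_immersion hι x)
  refine ⟨ρX, πX, hρXι, hπX, hManin, hμ.commutative.action, hμ.commutative.coisotropic,
    hμ.smooth.comp hι.contMDiff, ?_, ?_⟩
  · intro a x
    rw [hμd]
    exact (congrArg (mfderiv 𝓘(ℝ, E) 𝓘(ℝ, E') μ (ι x)) (hρXι a x)).trans
      (hμ.equivariant (a : 𝔡) (ι x))
  · intro x α β
    -- The restriction property concerns covectors of `M`, so `α` is extended from `TX` by `L`, and
    -- `β` is realised as a differential so that centrality applies.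
    obtain ⟨L, hL⟩ := QuasiPoisson.exists_leftInverse_mfderiv hι
    have hα : (α ∘L L x) ∘L mfderiv (𝓡 k) 𝓘(ℝ, E) ι x = α := by
      ext v
      exact congrArg α (hL x v)
    obtain ⟨F, hF, hFβ⟩ := QuasiPoisson.exists_diff_eq (μ (ι x)) β
    have hd : QuasiPoisson.diff E (F ∘ μ) (ι x) = β ∘L mfderiv 𝓘(ℝ, E) 𝓘(ℝ, E') μ (ι x) := by
      rw [QuasiPoisson.diff_comp_apply (hF.mdifferentiableAt _)
        (hμ.smooth.mdifferentiable (by simp) _), hFβ]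
    have h1 := hπX x (α ∘L L x) (β ∘L mfderiv 𝓘(ℝ, E) 𝓘(ℝ, E') μ (ι x))
    rw [QuasiPoisson.sub_pushTwo_twist_apply hc h𝔥L h𝔥s, hcompl, hα, ← hd,
      hμ.central F hF (ι x), zero_sub, hd] at h1
    have h2 : mfderiv 𝓘(ℝ, E) 𝓘(ℝ, E') μ (ι x)
        (ρ (QuasiPoisson.toComplement B hc (QuasiPoisson.actionDual ρX x α)) (ι x)) =
        ρN (QuasiPoisson.toComplement B hc (QuasiPoisson.actionDual ρX x α)) (μ (ι x)) :=
      hμ.equivariant _ _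
    rw [hμd]
    exact h1.trans (congrArg (fun v => -β v) h2)
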